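/- Let $G$ be a finite abelian group, $B\subseteq G$ and $k$ a positive integer. The $k$-th isoperimetric number of $B$ is $$\kappa_k(B)=\min\{\,|Y+B|-|Y| \;:\; Y\subseteq G,\ |Y|\ge k,\ |Y+B|\le |G|-k\,\},$$ with the convention $\min\emptyset=|G|$. A $k$-fragment of $B$ is a set $Y\subseteq G$ with $|Y|\ge k$ and $|Y+B|\le |G|-k$ for which $|Y+B|-|Y|=\kappa_k(B)$, and a $k$-atom of $B$ is a $k$-fragment of $B$ of minimal cardinality. Theorem. Let $p$ be a prime and let $X\subseteq \mathbb{Z}/p\mathbb{Z}$ be such that $0\in X$, $|X|\ge 4$, $\kappa_5(X)\le |X|+1$ and $p>|X|+42$. Then (i) every $4$-atom of $X$ has cardinality $4$; (ii) if $|X|=4$, then every $5$-atom of $X$ has cardinality $5$. -/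

import Mathlib

open scoped Pointwise

namespace Isoperimetric

section

variable {G : Type*} [AddCommGroup G] [Fintype G] [DecidableEq G]

/-- The sets `Y ⊆ G` with `|Y| ≥ k` and `|Y + B| ≤ |G| - k`, over which the `k`-th isoperimetric
number of `B` is a minimum. The second inequality is stated in `ℤ`, to avoid truncation. -/
def admissible (k : ℕ) (B : Finset G) : Finset (Finset G) :=
  Finset.univ.filter fun Y =>
    k ≤ Y.card ∧ ((Y + B).card : ℤ) ≤ (Fintype.card G : ℤ) - (k : ℤ)

/-- The quantity `|Y + B| - |Y|`, as an integer. -/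
def excess (B Y : Finset G) : ℤ := ((Y + B).card : ℤ) - (Y.card : ℤ)

/-- The `k`-th isoperimetric number
`κ_k(B) = min {|Y + B| - |Y| : |Y| ≥ k, |Y + B| ≤ |G| - k}`, where `min ∅ = |G|`. -/
def kappa (k : ℕ) (B : Finset G) : ℤ :=
  if h : (admissible k B).Nonempty then (admissible k B).inf' h (excess B)
  else (Fintype.card G : ℤ)

/-- A `k`-fragment of `B`: an admissible set that achieves the minimum `κ_k(B)`. -/
def IsFragment (k : ℕ) (B Y : Finset G) : Prop :=
  Y ∈ admissible k B ∧ excess B Y = kappa k B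

/-- A `k`-atom of `B`: a `k`-fragment of `B` of minimal cardinality. -/
def IsAtom (k : ℕ) (B Y : Finset G) : Prop :=
  IsFragment k B Y ∧ ∀ Z : Finset G, IsFragment k B Z → Y.card ≤ Z.card

end

end Isoperimetric

/-!
The quantity `excess S Z = |Z + S| - |Z|` is submodular in `Z`, and by Cauchy–Davenport it is at
least `|S| - 1`. Hence distinct translates of a `k`-atom meet in fewer than `k` points. Suppose that
a `k`-atom `A` of `X`, with `k = 4` or `k = 5` and `κ_k(X) ≤ |X| + 1`, has more than `k` elements.
Write `κ₂` for the second isoperimetric number.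

*Some translate of `A` meets `A` in all but at most three points.* For `k = 5` and `|X| = 4` this
is a count of the representations in `A + X`. For `k = 4` one takes a `2`-atom `B` of `A`. It is a
Sidon set, and `|B + A| ≤ |B| + |A| + 1` because `X` competes with `B` for `κ₂(A)`; comparing the
additive energy of `A` and `B` with the size of their sumset gives the claim unless `|B| = 2`, and
then the claim is the bound on `|B + A|` (`IsAtom.exists_card_le_card_inter_add_three`). So, for
some `d`, the set `A` consists of at most three runs with difference `d`, and `|A| ≤ k + 2`.

*Atoms do not fit into short progressions.* If `A` lay in a progression with `|A| + 2` terms, then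
`X` would have a gap of at least `|A| + 1` terms with the same difference. Across that gap a sum has
a single representation, and removing its summand in `A` would give a smaller fragment
(`IsAtom.false_of_subset_prog`).

*Few runs produce short progressions.* Let `W + S` have `N` elements more than `W` and let it have
no more runs than `W` has gaps longer than `N`. Then for each `a ∈ S` every long gap of `W + a`
contains exactly one gap of `W + S`. Adding up the displacements shows that `q • a` lies in a fixed
progression with `N + 1` terms, `q` being the number of runs (`exists_forall_card_mul_eq`). If the
condition on the gaps fails, closing all short gaps of `W` gives a set with fewer runs, which still
has minimal excess when `W` has; this leads to `exists_forall_natCast_mul_eq`.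

*Pairs.* If `κ₂(S) ≤ |S|`, then `κ₂(S)` is attained by a set with two elements, that is, by a
difference for which `S` has few runs (`exists_excess_pair_eq`). The energy estimate reduces this to
a `2`-atom with three elements, which is excluded by uncrossing (`false_of_triangle`).

*Conclusion.* If `A` has at most two runs for some difference, the matching of gaps applies to
`A + X`, or `X` has a single long gap and a count excludes this (`IsAtom.false_of_ends_le_two`).
Otherwise `κ₂(A) ≥ |A| + 1` by the result on pairs, which forces `κ_k(X) = |X| + 1` and makes `X` a
set of minimal excess with respect to `A`. If some difference gives `X` two runs, or three when
`|X| ≥ 5`, then `A` lies in a short progression. What remains is the case that `X` is a Sidon set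
with four elements (`IsAtom.false_of_sidon`, `IsAtom.false_of_sidon_of_card_eq_five`), and, for
`|X| ≥ 5`, the case without pairs of minimal excess, where uncrossing settles atoms with six
elements (`IsAtom.false_of_card_eq_six`).
-/

namespace Isoperimetric

open Finset

variable {p : ℕ} [Fact p.Prime]

/-! ### Translates, runs and the excess -/

lemma mem_add_singleton {A : Finset (ZMod p)} {t x : ZMod p} : x ∈ A + {t} ↔ x - t ∈ A := by
  simp only [Finset.mem_add, Finset.mem_singleton]
  constructor
  · rintro ⟨y, hy, z, rfl, rfl⟩
    simpa using hy
  · intro h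
    exact ⟨x - t, h, t, rfl, by ring⟩

/-- `grow d Z` is `Z ∪ (Z + d)`, written as a sumset so that it commutes with adding sets. -/
def grow (d : ZMod p) (Z : Finset (ZMod p)) : Finset (ZMod p) := Z + {0, d}

/-- The last elements of the runs of `Z` with difference `d`. If `d ≠ 0` and `Z` is a proper subset
of `ZMod p`, their number is the number of maximal progressions with difference `d` in `Z`. -/
def ends (d : ZMod p) (Z : Finset (ZMod p)) : Finset (ZMod p) := Z.filter fun z => z + d ∉ Z

lemma mem_ends {d x : ZMod p} {Z : Finset (ZMod p)} : x ∈ ends d Z ↔ x ∈ Z ∧ x + d ∉ Z := by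
  simp [ends]

lemma grow_eq_union (d : ZMod p) (Z : Finset (ZMod p)) : grow d Z = Z ∪ (Z + {d}) := by
  rw [grow, Finset.insert_eq, Finset.add_union, Finset.singleton_zero, add_zero]

lemma mem_grow {d x : ZMod p} {Z : Finset (ZMod p)} : x ∈ grow d Z ↔ x ∈ Z ∨ x - d ∈ Z := by
  rw [grow_eq_union, mem_union, mem_add_singleton]

lemma subset_grow (d : ZMod p) (Z : Finset (ZMod p)) : Z ⊆ grow d Z :=
  fun _ hx => mem_grow.2 (Or.inl hx)

lemma grow_add (d : ZMod p) (Z S : Finset (ZMod p)) : grow d Z + S = grow d (Z + S) := by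
  rw [grow, grow, add_right_comm]

lemma iterate_grow_add (d : ZMod p) (Z S : Finset (ZMod p)) (j : ℕ) :
    (grow d)^[j] Z + S = (grow d)^[j] (Z + S) := by
  induction j with
  | zero => rfl
  | succ j ih => rw [Function.iterate_succ_apply', Function.iterate_succ_apply', grow_add, ih]

lemma card_inter_add_card_ends (d : ZMod p) (Z : Finset (ZMod p)) :
    (Z ∩ (Z + {d})).card + (ends d Z).card = Z.card := by
  have h : (Z ∩ (Z + {d})).card = (Z.filter fun z => z + d ∈ Z).card := by
    refine (card_bij (fun z _ => z + d) ?_ ?_ ?_).symm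
    · intro z hz
      rw [mem_filter] at hz
      exact mem_inter.2 ⟨hz.2, mem_add_singleton.2 (by simpa using hz.1)⟩
    · intro a _ b _ h
      exact add_right_cancel h
    · intro b hb
      rw [mem_inter, mem_add_singleton] at hb
      exact ⟨b - d, mem_filter.2 ⟨hb.2, by simpa using hb.1⟩, sub_add_cancel b d⟩
  rw [h, ends, card_filter_add_card_filter_not]

lemma card_grow (d : ZMod p) (Z : Finset (ZMod p)) :
    (grow d Z).card = Z.card + (ends d Z).card := by
  have h1 := card_union_add_card_inter Z (Z + {d})
  have h2 := card_inter_add_card_ends d Z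
  rw [grow_eq_union]
  rw [card_add_singleton] at h1
  omega

lemma ends_grow_card_le (d : ZMod p) (Z : Finset (ZMod p)) :
    (ends d (grow d Z)).card ≤ (ends d Z).card := by
  refine card_le_card_of_injOn (fun z => z - d) ?_ (fun a _ b _ h => sub_left_injective h)
  intro z hz
  rw [mem_coe, mem_ends, mem_grow, mem_grow] at hz
  rw [mem_coe, mem_ends]
  simp only [add_sub_cancel_right, sub_add_cancel, not_or] at hz ⊢
  rcases hz with ⟨h1 | h1, h2, h3⟩
  · exact absurd h1 h3
  · exact ⟨h1, h3⟩

lemma ends_iterate_card_anti (d : ZMod p) (Z : Finset (ZMod p)) {i j : ℕ} (h : i ≤ j) :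
    (ends d ((grow d)^[j] Z)).card ≤ (ends d ((grow d)^[i] Z)).card := by
  induction j, h using Nat.le_induction with
  | base => exact le_rfl
  | succ j _ ih =>
    rw [Function.iterate_succ_apply']
    exact (ends_grow_card_le d _).trans ih

lemma subset_iterate_grow (d : ZMod p) (Z : Finset (ZMod p)) {i j : ℕ} (h : i ≤ j) :
    (grow d)^[i] Z ⊆ (grow d)^[j] Z := by
  induction j, h using Nat.le_induction with
  | base => exact Subset.rfl
  | succ j _ ih =>
    rw [Function.iterate_succ_apply']
    exact ih.trans (subset_grow d _)

lemma card_iterate_grow_le (d : ZMod p) (Z : Finset (ZMod p)) (j : ℕ) :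
    ((grow d)^[j] Z).card ≤ Z.card + j * (ends d Z).card := by
  induction j with
  | zero => simp
  | succ j ih =>
    rw [Function.iterate_succ_apply', card_grow]
    have := ends_iterate_card_anti d Z (Nat.zero_le j)
    simp only [Function.iterate_zero, id] at this
    rw [Nat.succ_mul]
    omega

lemma mem_iterate_grow {d x : ZMod p} {Z : Finset (ZMod p)} {j : ℕ} :
    x ∈ (grow d)^[j] Z ↔ ∃ i ≤ j, x - i * d ∈ Z := by
  induction j generalizing x with
  | zero => simp
  | succ j ih =>
    rw [Function.iterate_succ_apply', mem_grow, ih, ih]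
    constructor
    · rintro (⟨i, hi, h⟩ | ⟨i, hi, h⟩)
      · exact ⟨i, by omega, h⟩
      · refine ⟨i + 1, by omega, ?_⟩
        convert h using 1
        push_cast
        ring
    · rintro ⟨i, hi, h⟩
      rcases Nat.lt_or_ge i (j + 1) with h' | h'
      · exact Or.inl ⟨i, by omega, h⟩
      · right
        refine ⟨j, le_rfl, ?_⟩
        obtain rfl : i = j + 1 := by omega
        convert h using 1
        push_cast
        ring

lemma card_le_prime (Z : Finset (ZMod p)) : Z.card ≤ p := by
  simpa [ZMod.card] using card_le_univ Z

lemma exists_nat_mul {d : ZMod p} (hd : d ≠ 0) (x : ZMod p) : ∃ i : ℕ, x = i * d :=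
  ⟨(x / d).val, by rw [ZMod.natCast_zmod_val, div_mul_cancel₀ _ hd]⟩

lemma exists_first_not_mem {d : ZMod p} (hd : d ≠ 0) {Z : Finset (ZMod p)} (hZ : Z.card < p)
    (z : ZMod p) : ∃ i : ℕ, z + i * d ∉ Z ∧ ∀ j < i, z + j * d ∈ Z := by
  have hne : ∃ x, x ∉ Z := by
    by_contra! h
    have : Z = univ := by ext; simp [h]
    rw [this, card_univ, ZMod.card] at hZ
    exact lt_irrefl _ hZ
  obtain ⟨x, hx⟩ := hne
  obtain ⟨i, hi⟩ := exists_nat_mul hd (x - z)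
  have hex : ∃ i : ℕ, z + i * d ∉ Z := ⟨i, by rw [← hi]; simpa using hx⟩
  classical
  exact ⟨Nat.find hex, Nat.find_spec hex, fun j hj => not_not.1 (Nat.find_min hex hj)⟩

lemma exists_end {d : ZMod p} (hd : d ≠ 0) {Z : Finset (ZMod p)} (hZ : Z.card < p) {z : ZMod p}
    (hz : z ∈ Z) : ∃ i : ℕ, z + i * d ∈ ends d Z ∧ ∀ j ≤ i, z + j * d ∈ Z := by
  obtain ⟨i, hi, hj⟩ := exists_first_not_mem hd hZ z
  rcases i with _ | i
  · simp [hz] at hi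
  · refine ⟨i, mem_ends.2 ⟨hj i (Nat.lt_succ_self i), ?_⟩, fun j h => hj j (Nat.lt_succ_of_le h)⟩
    have h : z + i * d + d = z + ((i + 1 : ℕ) : ZMod p) * d := by
      push_cast
      ring
    rwa [h]

lemma ends_nonempty {d : ZMod p} (hd : d ≠ 0) {Z : Finset (ZMod p)} (hZ : Z.card < p)
    (hne : Z.Nonempty) : 0 < (ends d Z).card := by
  obtain ⟨z, hz⟩ := hne
  obtain ⟨i, hi, -⟩ := exists_end hd hZ hz
  exact card_pos.2 ⟨_, hi⟩

lemma card_inter_translate_lt {d : ZMod p} (hd : d ≠ 0) {Z : Finset (ZMod p)} (hZ : Z.card < p)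
    (hne : Z.Nonempty) : (Z ∩ (Z + {d})).card < Z.card := by
  have h1 := card_inter_add_card_ends d Z
  have h2 := ends_nonempty hd hZ hne
  omega

lemma natCast_mul_injOn {d : ZMod p} (hd : d ≠ 0) {i j : ℕ} (hi : i < p) (hj : j < p)
    (h : (i : ZMod p) * d = j * d) : i = j := by
  have h' := mul_right_cancel₀ hd h
  have := (ZMod.natCast_eq_natCast_iff' i j p).1 h'
  rwa [Nat.mod_eq_of_lt hi, Nat.mod_eq_of_lt hj] at this

/-- The progression `{0, d, …, L * d}`. -/
def prog (d : ZMod p) (L : ℕ) : Finset (ZMod p) := (grow d)^[L] {0}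

lemma mem_prog {d x : ZMod p} {L : ℕ} : x ∈ prog d L ↔ ∃ i ≤ L, x = i * d := by
  rw [prog, mem_iterate_grow]
  simp [sub_eq_zero]

lemma card_prog {d : ZMod p} (hd : d ≠ 0) {L : ℕ} (hL : L < p) : (prog d L).card = L + 1 := by
  have : prog d L = (range (L + 1)).image fun i : ℕ => (i : ZMod p) * d := by
    ext x
    rw [mem_prog, mem_image]
    simp only [mem_range, Nat.lt_succ_iff, eq_comm]
  rw [this, card_image_of_injOn, card_range]
  intro i hi j hj h
  simp only [coe_range, Set.mem_Iio] at hi hj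
  exact natCast_mul_injOn hd (by omega) (by omega) h

lemma exists_eq_prog {d : ZMod p} (hd : d ≠ 0) {Z : Finset (ZMod p)} (hZ : Z.card < p)
    (hne : Z.Nonempty) (h1 : (ends d Z).card ≤ 1) :
    ∃ z, ∃ L : ℕ, Z.card = L + 1 ∧ Z = prog d L + {z} := by
  classical
  obtain ⟨w, hw⟩ := card_pos.1 (ends_nonempty hd hZ hne)
  have huniq : ∀ x ∈ ends d Z, x = w := fun x hx => card_le_one.1 h1 x hx w hw
  -- the run that ends in `w` is followed backwards until it stops
  obtain ⟨M, hM, hlt⟩ := exists_first_not_mem (neg_ne_zero.2 hd) hZ w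
  rcases M with _ | M
  · simp [(mem_ends.1 hw).1] at hM
  have hZeq : Z = prog d M + {w - M * d} := by
    ext x
    rw [mem_add_singleton, mem_prog]
    constructor
    · intro hx
      obtain ⟨i, hi, hij⟩ := exists_end hd hZ hx
      have hxi := huniq _ hi
      have hiM : i ≤ M := by
        by_contra hcon
        apply hM
        have := hij (i - (M + 1)) (by omega)
        rw [Nat.cast_sub (by omega : M + 1 ≤ i)] at this
        convert this using 1
        rw [← hxi]
        ring
      refine ⟨M - i, by omega, ?_⟩
      rw [Nat.cast_sub hiM, ← hxi]
      ring
    · rintro ⟨i, hi, hx⟩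
      have := hlt (M - i) (by omega)
      rw [Nat.cast_sub hi] at this
      convert this using 1
      linear_combination hx
  have hMp : M < p := by
    by_contra hcon
    have h2 := hlt (p - 1) (by omega)
    have hp : 1 ≤ p := (Fact.out : p.Prime).one_lt.le
    apply (mem_ends.1 hw).2
    rw [Nat.cast_sub hp] at h2
    simpa using h2
  refine ⟨_, M, ?_, hZeq⟩
  rw [hZeq, card_add_singleton, card_prog hd hMp]

/-! ### Excess -/

lemma card_add_eq (S Z : Finset (ZMod p)) :
    ((Z + S).card : ℤ) = Z.card + excess S Z := by
  simp [excess]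

lemma excess_add_singleton (S Z : Finset (ZMod p)) (t : ZMod p) :
    excess S (Z + {t}) = excess S Z := by
  rw [excess, excess, add_right_comm, card_add_singleton, card_add_singleton]

lemma excess_comm (S Z : Finset (ZMod p)) :
    excess S Z = excess Z S + S.card - Z.card := by
  rw [excess, excess, add_comm Z S]
  ring

lemma excess_union_add_excess_inter_le (S U V : Finset (ZMod p)) :
    excess S (U ∪ V) + excess S (U ∩ V) ≤ excess S U + excess S V := by
  have h1 := card_union_add_card_inter (U + S) (V + S)
  have h2 := card_union_add_card_inter U V
  have h3 : (U ∪ V + S).card = ((U + S) ∪ (V + S)).card := by rw [union_add]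
  have h4 : (U ∩ V + S).card ≤ ((U + S) ∩ (V + S)).card := card_le_card inter_add_subset
  simp only [excess]
  omega

lemma excess_grow (S Z : Finset (ZMod p)) (d : ZMod p) :
    excess S (grow d Z) = excess S Z + (ends d (Z + S)).card - (ends d Z).card := by
  rw [excess, excess, grow_add, card_grow, card_grow]
  push_cast
  ring

lemma excess_grow_add_excess_inter_le (S Z : Finset (ZMod p)) (d : ZMod p) :
    excess S (grow d Z) + excess S (Z ∩ (Z + {d})) ≤ 2 * excess S Z := by
  have := excess_union_add_excess_inter_le S Z (Z + {d})
  rw [excess_add_singleton, ← grow_eq_union] at this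
  linarith

lemma excess_pair (S : Finset (ZMod p)) {d : ZMod p} (hd : d ≠ 0) :
    excess S {0, d} = S.card + (ends d S).card - 2 := by
  have h : ({0, d} + S : Finset (ZMod p)) = grow d S := by rw [grow, add_comm]
  rw [excess, h, card_grow, card_pair hd.symm]
  push_cast
  ring

lemma le_excess_of_lt {S Z : Finset (ZMod p)} (hS : S.Nonempty) (hZ : Z.Nonempty)
    (h : (Z + S).card < p) : (S.card : ℤ) - 1 ≤ excess S Z := by
  have h1 := ZMod.cauchy_davenport (Fact.out : p.Prime) hZ hS
  have h2 := hS.card_pos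
  rw [excess]
  omega

/-! ### Fragments and atoms -/

lemma mem_admissible {k : ℕ} {S Z : Finset (ZMod p)} :
    Z ∈ admissible k S ↔ k ≤ Z.card ∧ (Z + S).card + k ≤ p := by
  simp only [admissible, mem_filter, mem_univ, true_and, ZMod.card]
  omega

lemma kappa_le_excess {k : ℕ} {S Z : Finset (ZMod p)} (hk : k ≤ Z.card)
    (hZ : (Z + S).card + k ≤ p) : kappa k S ≤ excess S Z := by
  have hmem : Z ∈ admissible k S := mem_admissible.2 ⟨hk, hZ⟩
  rw [kappa, dif_pos ⟨Z, hmem⟩]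
  exact inf'_le _ hmem

lemma admissible_nonempty {k : ℕ} {S : Finset (ZMod p)} (h : kappa k S < p) :
    (admissible k S).Nonempty := by
  by_contra hne
  rw [kappa, dif_neg hne, ZMod.card] at h
  exact lt_irrefl _ h

lemma exists_isAtom {k : ℕ} {S : Finset (ZMod p)} (h : kappa k S < p) : ∃ A, IsAtom k S A := by
  classical
  have hne := admissible_nonempty h
  obtain ⟨A, hA, hAe⟩ := exists_mem_eq_inf' hne (excess S)
  have hfrag : IsFragment k S A := ⟨hA, by rw [kappa, dif_pos hne, hAe]⟩
  obtain ⟨B, hB, hmin⟩ := exists_min_image (univ.filter fun Z => IsFragment k S Z) card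
    ⟨A, by simpa using hfrag⟩
  simp only [mem_filter, mem_univ, true_and] at hB hmin
  exact ⟨B, hB, hmin⟩

lemma kappa_mono {k l : ℕ} {S : Finset (ZMod p)} (hkl : k ≤ l) (h : kappa l S < p) :
    kappa k S ≤ kappa l S := by
  obtain ⟨A, ⟨hA, hAe⟩, -⟩ := exists_isAtom h
  rw [mem_admissible] at hA
  rw [← hAe]
  exact kappa_le_excess (by omega) (by omega)

namespace IsAtom

variable {k : ℕ} {S A : Finset (ZMod p)}

lemma le_card (h : IsAtom k S A) : k ≤ A.card := (mem_admissible.1 h.1.1).1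

lemma card_add_le (h : IsAtom k S A) : (A + S).card + k ≤ p := (mem_admissible.1 h.1.1).2

lemma excess_eq (h : IsAtom k S A) : excess S A = kappa k S := h.1.2

lemma kappa_lt_excess (h : IsAtom k S A) {Z : Finset (ZMod p)} (hk : k ≤ Z.card)
    (hlt : Z.card < A.card) (hZ : (Z + S).card + k ≤ p) : kappa k S < excess S Z := by
  refine lt_of_le_of_ne (kappa_le_excess hk hZ) fun he => ?_
  have := h.2 Z ⟨mem_admissible.2 ⟨hk, hZ⟩, he.symm⟩
  omega

/-- The negative of the complement of `A + S` is a fragment too, so an atom is at most as large. -/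
lemma card_add_card_add_le (h : IsAtom k S A) : A.card + (A + S).card ≤ p := by
  have hk := h.le_card
  have hA := h.card_add_le
  set F : Finset (ZMod p) := -(A + S)ᶜ with hF
  have hFc : F.card + (A + S).card = p := by
    rw [hF, card_neg, card_compl, ZMod.card]
    omega
  have hdisj : Disjoint (F + S) (-A) := by
    rw [disjoint_left]
    intro x hx hxA
    obtain ⟨f, hf, s, hs, rfl⟩ := mem_add.1 hx
    rw [hF, mem_neg'] at hf
    rw [mem_neg'] at hxA
    apply mem_compl.1 hf
    have := add_mem_add hxA hs
    convert this using 1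
    ring
  have hcard : (F + S).card + A.card ≤ p := by
    rw [← card_neg A, ← card_union_of_disjoint hdisj]
    exact card_le_prime _
  have hadm : F ∈ admissible k S := mem_admissible.2 ⟨by omega, by omega⟩
  have hex : excess S F ≤ kappa k S := by
    rw [← h.excess_eq, excess, excess]
    omega
  have := h.2 F ⟨hadm, le_antisymm hex (kappa_le_excess (by omega) (by omega))⟩
  omega

/-- Distinct translates of a `k`-atom have fewer than `k` points in common. -/
lemma card_inter_lt (h : IsAtom k S A) (hS : S.Nonempty) (hk : 1 ≤ k) {t : ZMod p} (ht : t ≠ 0) :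
    (A ∩ (A + {t})).card < k := by
  by_contra! hcon
  have hkA := h.le_card
  have hA := h.card_add_le
  have hdual := h.card_add_card_add_le
  have hAS : A.card ≤ (A + S).card := card_le_card_add_right hS
  have hlt : (A ∩ (A + {t})).card < A.card :=
    card_inter_translate_lt ht (by omega) (card_pos.1 (by omega))
  have hsub : ((A ∩ (A + {t})) + S).card ≤ (A + S).card :=
    card_le_card (add_subset_add_right inter_subset_left)
  have h1 := h.kappa_lt_excess hcon hlt (by omega)
  have h2 := excess_grow_add_excess_inter_le S A t
  have h3 := card_inter_add_card_ends t A
  have h4 := card_grow t A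
  have h5 := h.excess_eq
  have h6 : (grow t A).card ≤ 2 * A.card - k := by omega
  have h7 : ((grow t A + S).card : ℤ) < (grow t A).card + kappa k S := by
    rw [card_add_eq]; omega
  have h8 := card_add_eq S A
  have := kappa_le_excess (k := k) (S := S) (Z := grow t A) (by omega) (by omega)
  omega

end IsAtom

/-! ### Matching the gaps of a set with those of a sumset -/

/-- The last elements of those runs of `W` that are followed by a gap longer than `N`. -/
def longEnds (d : ZMod p) (N : ℕ) (W : Finset (ZMod p)) : Finset (ZMod p) :=
  ends d ((grow d)^[N] W) + {-(N * d)}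

lemma mem_longEnds {d w : ZMod p} {N : ℕ} {W : Finset (ZMod p)} :
    w ∈ longEnds d N W ↔ w ∈ W ∧ ∀ i : ℕ, 1 ≤ i → i ≤ N + 1 → w + i * d ∉ W := by
  rw [longEnds, mem_add_singleton, mem_ends, mem_iterate_grow, mem_iterate_grow]
  constructor
  · rintro ⟨⟨i, hi, h⟩, h2⟩
    have h3 : ∀ j : ℕ, 1 ≤ j → j ≤ N + 1 → w + j * d ∉ W := by
      intro j hj1 hj hw
      apply h2
      refine ⟨N + 1 - j, by omega, ?_⟩
      rw [Nat.cast_sub hj]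
      convert hw using 1
      push_cast
      ring
    refine ⟨?_, h3⟩
    rcases Nat.lt_or_ge i N with h' | h'
    · exfalso
      apply h3 (N - i) (by omega) (by omega)
      rw [Nat.cast_sub hi]
      convert h using 1
      ring
    · obtain rfl : i = N := le_antisymm hi h'
      convert h using 1
      ring
  · rintro ⟨hw, h⟩
    refine ⟨⟨N, le_rfl, by convert hw using 1; ring⟩, ?_⟩
    rintro ⟨i, hi, h'⟩
    apply h (N + 1 - i) (by omega) (by omega)
    rw [Nat.cast_sub (by omega : i ≤ N + 1)]
    convert h' using 1
    push_cast
    ring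

lemma card_longEnds (d : ZMod p) (N : ℕ) (W : Finset (ZMod p)) :
    (longEnds d N W).card = (ends d ((grow d)^[N] W)).card := by
  rw [longEnds, card_add_singleton]

/-- If `W + S` has at most `N` elements more than `W` and no more runs than `W` has gaps longer
than `N`, then for every `a ∈ S` each long gap of `W + a` contains exactly one gap of `W + S`.
Summing the displacements of the ends of the runs locates `q • a`, with `q` the number of runs. -/
lemma exists_forall_card_mul_eq {S W : Finset (ZMod p)} {d : ZMod p} {N : ℕ}
    (hN : (W + S).card ≤ W.card + N)
    (hends : (ends d (W + S)).card ≤ (longEnds d N W).card) :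
    ∃ c : ZMod p, ∀ a ∈ S, ∃ i ≤ N, ((longEnds d N W).card : ZMod p) * a = c - i * d := by
  classical
  refine ⟨∑ y ∈ ends d (W + S), y - ∑ w ∈ longEnds d N W, w, fun a ha => ?_⟩
  set Y := W + S with hY
  set L := longEnds d N W with hL
  have hsub : W + {a} ⊆ Y := add_subset_add_left (singleton_subset_iff.2 ha)
  have hdiff : (Y \ (W + {a})).card ≤ N := by
    rw [card_sdiff_of_subset hsub, card_add_singleton]
    omega
  -- distinct long gaps stay disjoint within distance `N + 1`
  have hgap : ∀ w ∈ L, ∀ w' ∈ L, ∀ i j : ℕ, i ≤ N + 1 → j ≤ N + 1 →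
      w + i * d = w' + j * d → w = w' := by
    have key : ∀ w ∈ L, ∀ w' ∈ L, ∀ i j : ℕ, j ≤ N + 1 → i ≤ j →
        w + i * d = w' + j * d → w = w' := by
      intro w hw w' hw' i j hj hij he
      rw [hL, mem_longEnds] at hw hw'
      rcases Nat.eq_or_lt_of_le hij with h | h
      · rw [h] at he
        exact add_right_cancel he
      · exfalso
        apply hw'.2 (j - i) (by omega) (by omega)
        rw [Nat.cast_sub hij]
        convert hw.1 using 1
        linear_combination -he
    intro w hw w' hw' i j hi hj he
    rcases Nat.le_total i j with h | h
    · exact key w hw w' hw' i j hj h he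
    · exact (key w' hw' w hw j i hi h he.symm).symm
  -- a long gap of `W + a` cannot be filled completely by `Y`
  have hk : ∀ w ∈ L, ∃ k ≤ N, w + a + (k + 1 : ℕ) * d ∉ Y ∧ ∀ i ≤ k, w + a + i * d ∈ Y := by
    intro w hw
    have hw' := mem_longEnds.1 (hL ▸ hw)
    have hex : ∃ k : ℕ, w + a + (k + 1 : ℕ) * d ∉ Y ∧ k ≤ N := by
      by_contra! hcon
      have : N + 1 ≤ (Y \ (W + {a})).card := by
        rw [← card_range (N + 1)]
        refine card_le_card_of_injOn (fun k : ℕ => w + a + (k + 1 : ℕ) * d) ?_ ?_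
        · intro k hk
          simp only [coe_range, Set.mem_Iio] at hk
          rw [mem_coe, mem_sdiff, mem_add_singleton]
          refine ⟨?_, ?_⟩
          · by_contra h
            have := hcon k h
            omega
          · intro h
            apply hw'.2 (k + 1) (by omega) (by omega)
            convert h using 1
            ring
        · intro i hi j hj h
          simp only [coe_range, Set.mem_Iio] at hi hj
          by_contra hne
          have hlt : ∀ i j : ℕ, i < j → j < N + 1 →
              w + a + (i + 1 : ℕ) * d = w + a + (j + 1 : ℕ) * d → False := by
            intro i j hij hj h
            apply hw'.2 (j - i) (by omega) (by omega)
            rw [Nat.cast_sub hij.le]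
            convert hw'.1 using 1
            push_cast at h
            linear_combination -h
          rcases lt_or_gt_of_ne hne with h' | h'
          · exact hlt i j h' hj h
          · exact hlt j i h' hi h.symm
      omega
    refine ⟨Nat.find hex, (Nat.find_spec hex).2, (Nat.find_spec hex).1, fun i hi => ?_⟩
    rcases i with _ | i
    · simpa using hsub (mem_add_singleton.2 (by simpa using hw'.1) : w + a ∈ W + {a})
    · have := Nat.find_min hex (m := i) (by omega)
      have h2 := (Nat.find_spec hex).2
      by_contra h
      exact this ⟨h, by omega⟩
  choose! k hkN hkY hkin using hk
  -- the first gap of `Y` in each long gap of `W + a` gives the bijection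
  have hmaps : Set.MapsTo (fun w => w + a + k w * d) L (ends d Y) := by
    intro w hw
    rw [mem_coe, mem_ends]
    refine ⟨hkin w hw _ le_rfl, ?_⟩
    have := hkY w hw
    push_cast at this
    convert this using 2
    ring
  have hinj : Set.InjOn (fun w => w + a + k w * d) L := by
    intro w hw w' hw' h
    have h1 := hkN w hw
    have h2 := hkN w' hw'
    refine hgap w hw w' hw' (k w) (k w') (by omega) (by omega) ?_
    simp only at h
    linear_combination h
  have himg : L.image (fun w => w + a + k w * d) = ends d Y := by
    refine eq_of_subset_of_card_le (image_subset_iff.2 hmaps) ?_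
    rw [card_image_of_injOn hinj]
    exact hends
  have hsum : ∑ y ∈ ends d Y, y = ∑ w ∈ L, (w + a + k w * d) := by
    rw [← himg, sum_image hinj]
  refine ⟨∑ w ∈ L, k w, ?_, ?_⟩
  · refine le_trans ?_ hdiff
    rw [show ∑ w ∈ L, k w = (L.sigma fun w => range (k w)).card by simp]
    refine card_le_card_of_injOn
      (fun x : (_ : ZMod p) × ℕ => x.1 + a + (x.2 + 1 : ℕ) * d) ?_ ?_
    · rintro ⟨w, i⟩ hx
      simp only [coe_sigma, coe_range, Set.mem_sigma_iff, mem_coe, Set.mem_Iio] at hx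
      have h1 := hkN w hx.1
      rw [mem_coe, mem_sdiff, mem_add_singleton]
      refine ⟨hkin w hx.1 _ hx.2, fun h => ?_⟩
      apply (mem_longEnds.1 (hL ▸ hx.1)).2 (i + 1) (by omega) (by omega)
      convert h using 1
      ring
    · rintro ⟨w, i⟩ hx ⟨w', j⟩ hx' h
      simp only [coe_sigma, coe_range, Set.mem_sigma_iff, mem_coe, Set.mem_Iio] at hx hx' h
      have h1 := hkN w hx.1
      have h2 := hkN w' hx'.1
      have hww : w = w' := hgap w hx.1 w' hx'.1 (i + 1) (j + 1) (by omega) (by omega)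
        (by linear_combination h)
      subst hww
      have hij : i = j := by
        have hlt : ∀ i j : ℕ, i < j → j < k w →
            w + a + (i + 1 : ℕ) * d = w + a + (j + 1 : ℕ) * d → False := by
          intro i j hij hj h
          have hw' := mem_longEnds.1 (hL ▸ hx.1)
          apply hw'.2 (j - i) (by omega) (by omega)
          rw [Nat.cast_sub hij.le]
          convert hw'.1 using 1
          push_cast at h
          linear_combination -h
        rcases lt_trichotomy i j with h' | h' | h'
        · exact (hlt i j h' hx'.2 h).elim
        · exact h'
        · exact (hlt j i h' hx.2 h.symm).elim
      rw [hij]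
  · rw [hsum, sum_add_distrib, sum_add_distrib, sum_const, nsmul_eq_mul, ← sum_mul]
    push_cast
    ring

/-! ### Triangles and pairs -/

lemma eq_zero_of_natCast_mul {k : ℕ} (h0 : 0 < k) (hk : k < p) {x : ZMod p}
    (h : (k : ZMod p) * x = 0) : x = 0 := by
  rcases mul_eq_zero.1 h with h | h
  · have := Nat.le_of_dvd h0 ((ZMod.natCast_eq_zero_iff k p).1 h)
    omega
  · exact h

lemma exists_eq_pair_add {Z : Finset (ZMod p)} (hZ : Z.card = 2) :
    ∃ d ≠ 0, ∃ t, Z = {0, d} + {t} := by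
  obtain ⟨x, y, hxy, rfl⟩ := card_eq_two.1 hZ
  refine ⟨y - x, sub_ne_zero.2 hxy.symm, x, ?_⟩
  ext z
  simp [mem_add_singleton, sub_eq_zero]

lemma exists_eq_triple_add {B : Finset (ZMod p)} (hB : B.card = 3) :
    ∃ u v t, u ≠ 0 ∧ v ≠ 0 ∧ u ≠ v ∧ B = {0, u, v} + {t} := by
  obtain ⟨x, y, z, hxy, hxz, hyz, rfl⟩ := card_eq_three.1 hB
  refine ⟨y - x, z - x, x, sub_ne_zero.2 hxy.symm, sub_ne_zero.2 hxz.symm,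
    fun h => hyz (sub_left_injective h), ?_⟩
  ext w
  simp [mem_add_singleton, sub_eq_zero]

lemma card_inter_translate_add (Z : Finset (ZMod p)) (s t : ZMod p) :
    ((Z + {s}) ∩ (Z + {s} + {t})).card = (Z ∩ (Z + {t})).card := by
  rw [← card_add_singleton (Z ∩ (Z + {t})) s]
  congr 1
  ext x
  simp only [mem_inter, mem_add_singleton, sub_right_comm x t s]

lemma sidon_triple_ne {u v : ZMod p} (hu : u ≠ 0) (hv : v ≠ 0) (huv : u ≠ v)
    (hS : ∀ t ≠ 0, (({0, u, v} : Finset (ZMod p)) ∩ ({0, u, v} + {t})).card ≤ 1) :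
    v ≠ 2 * u ∧ u ≠ 2 * v := by
  refine ⟨fun h => huv ?_, fun h => huv ?_⟩
  · refine card_le_one.1 (hS u hu) u ?_ v ?_
    · simp [mem_add_singleton]
    · simp [mem_add_singleton, h, two_mul]
  · refine card_le_one.1 (hS v hv) u ?_ v ?_
    · simp [mem_add_singleton, h, two_mul]
    · simp [mem_add_singleton]

/-- Uncrossing: if no set with two elements has excess `c`, the minimal value, then two sets of
excess `c` meeting in at least two points meet in at least three. -/
lemma excess_union_le_of_two_le {S U V : Finset (ZMod p)} {c : ℤ}
    (hlow : ∀ Z : Finset (ZMod p), 2 ≤ Z.card → (Z + S).card + 2 ≤ p → c ≤ excess S Z)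
    (hpair : ∀ f ≠ 0, c + 1 ≤ excess S {0, f}) (hU : excess S U ≤ c) (hV : excess S V ≤ c)
    (hroom : ((U ∪ V).card : ℤ) + c + 2 ≤ p) (hUV : 2 ≤ (U ∩ V).card) :
    excess S (U ∪ V) ≤ c ∧ (U ∩ V).card ≠ 2 := by
  have h1 := excess_union_add_excess_inter_le S U V
  have h2 : ((U ∩ V) + S).card ≤ (U + S).card :=
    card_le_card (add_subset_add_right inter_subset_left)
  have h3 : U.card ≤ (U ∪ V).card := card_le_card subset_union_left
  have h4 := card_add_eq S U
  have h5 := hlow _ hUV (by omega)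
  have h6 : 2 ≤ (U ∪ V).card := hUV.trans (card_le_card (inter_subset_left.trans subset_union_left))
  refine ⟨by omega, fun h => ?_⟩
  obtain ⟨d, hd, t, ht⟩ := exists_eq_pair_add h
  have h7 := hpair d hd
  rw [ht, excess_add_singleton] at h1
  have h8 := card_add_eq S (U ∪ V)
  have h9 := hlow _ h6 (by omega)
  omega

/-- If no set with two elements has excess `c`, the minimal value, and the triangle `{0, u, v}` and
its double `D` have excess `c`, then `3 • v` lies in `D ∪ (D + u)`. -/
lemma three_mul_mem_of_triangle {S : Finset (ZMod p)} {c : ℤ} {u v : ZMod p}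
    (hlow : ∀ Z : Finset (ZMod p), 2 ≤ Z.card → (Z + S).card + 2 ≤ p → c ≤ excess S Z)
    (hpair : ∀ f ≠ 0, c + 1 ≤ excess S {0, f}) (hroom : c + 20 ≤ p) (hu : u ≠ 0)
    (hV : excess S {0, u, v} ≤ c)
    (hVV : excess S {0, u, v, 2 * u, 2 * v, u + v} ≤ c) :
    3 * v ∈ ({0, u, v, 2 * u, 2 * v, u + v} : Finset (ZMod p)) ∪
      ({0, u, v, 2 * u, 2 * v, u + v} + {u}) := by
  set D : Finset (ZMod p) := {0, u, v, 2 * u, 2 * v, u + v} with hD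
  have hDc : D.card ≤ 6 := card_le_six
  have h1 := card_union_le D (D + {u})
  rw [card_add_singleton] at h1
  have hU := excess_union_le_of_two_le hlow hpair hVV
    ((excess_add_singleton S D u).le.trans hVV) (by omega) (by
      rw [← card_pair (show u ≠ 2 * u by intro h; apply hu; linear_combination -h)]
      apply card_le_card
      intro x hx
      simp only [mem_insert, mem_singleton] at hx
      rw [mem_inter, mem_add_singleton]
      rcases hx with rfl | rfl
      · simp [hD]
      · constructor
        · simp [hD]
        · rw [hD, two_mul, add_sub_cancel_right]
          simp)
  set T : Finset (ZMod p) := {0, u, v} + {2 * v} with hT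
  have hTc : T.card ≤ 3 := by
    rw [hT, card_add_singleton]
    exact card_le_three
  have hTe : excess S T ≤ c := (excess_add_singleton S {0, u, v} (2 * v)).le.trans hV
  have h2 := card_union_le (D ∪ (D + {u})) T
  have hne : 2 * v ≠ u + 2 * v := by
    intro h; apply hu; linear_combination -h
  have hsub : ({2 * v, u + 2 * v} : Finset (ZMod p)) ⊆ (D ∪ (D + {u})) ∩ T := by
    intro x hx
    simp only [mem_insert, mem_singleton] at hx
    rw [mem_inter, mem_union, mem_add_singleton, hT, mem_add_singleton]
    rcases hx with rfl | rfl
    · simp [hD]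
    · refine ⟨Or.inr ?_, ?_⟩
      · rw [add_sub_cancel_left]
        simp [hD]
      · simp
  have hge := card_le_card hsub
  rw [card_pair hne] at hge
  have h3 := (excess_union_le_of_two_le hlow hpair hU.1
    hTe (by omega) hge).2
  have hmem : 3 * v ∈ D ∪ (D + {u}) := by
    by_contra hcon
    apply h3
    rw [← card_pair hne]
    congr 1
    refine (Subset.antisymm hsub ?_).symm
    intro x hx
    rw [mem_inter, hT, mem_add_singleton] at hx
    obtain ⟨hx1, hx2⟩ := hx
    simp only [mem_insert, mem_singleton] at hx2 ⊢
    rcases hx2 with h | h | h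
    · left; linear_combination h
    · right; linear_combination h
    · exact absurd hx1 (by rwa [show x = 3 * v by linear_combination h])
  exact hmem

lemma eq_of_three_mul_mem {u v : ZMod p} (hp : 11 < p) (hv : v ≠ 0)
    (huv : u ≠ v) (h2v : u ≠ 2 * v)
    (hmem : 3 * v ∈ ({0, u, v, 2 * u, 2 * v, u + v} : Finset (ZMod p)) ∪
      ({0, u, v, 2 * u, 2 * v, u + v} + {u})) : u = 3 * v ∨ 2 * u = 3 * v := by
  rw [mem_union, mem_add_singleton] at hmem
  simp only [mem_insert, mem_singleton] at hmem
  have e1 : ∀ {x : ZMod p} (k : ℕ), 0 < k → k < 12 → (k : ZMod p) * x = 0 → x = 0 :=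
    fun k h0 hk => eq_zero_of_natCast_mul h0 (by omega)
  rcases hmem with (h | h | h | h | h | h) | (h | h | h | h | h | h)
  · exact (hv (e1 3 (by omega) (by omega) (by push_cast; linear_combination h))).elim
  · exact Or.inl h.symm
  · exact (hv (e1 2 (by omega) (by omega) (by push_cast; linear_combination h))).elim
  · exact Or.inr h.symm
  · exact (hv (by linear_combination h)).elim
  · exact (h2v (by linear_combination -h)).elim
  · exact Or.inl (by linear_combination -h)
  · exact Or.inr (by linear_combination -h)
  · exact (h2v (by linear_combination -h)).elim
  · exact (huv (sub_eq_zero.1 (e1 3 (by omega) (by omega)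
      (by push_cast; linear_combination -h)))).elim
  · exact (huv (by linear_combination -h)).elim
  · exact (huv (sub_eq_zero.1 (e1 2 (by omega) (by omega)
      (by push_cast; linear_combination -h)))).elim

/-- In a situation without pairs of minimal excess, a triangle `V` and its double cannot both have
minimal excess: `3 • v` would have to lie in `V + V ∪ (V + V + u)`, and likewise with `u` and `v`
interchanged. -/
lemma false_of_triangle {S : Finset (ZMod p)} {c : ℤ} {u v : ZMod p}
    (hlow : ∀ Z : Finset (ZMod p), 2 ≤ Z.card → (Z + S).card + 2 ≤ p → c ≤ excess S Z)
    (hpair : ∀ f ≠ 0, c + 1 ≤ excess S {0, f}) (hroom : c + 20 ≤ p) (hp : 11 < p)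
    (hu : u ≠ 0) (hv : v ≠ 0) (huv : u ≠ v) (h2u : v ≠ 2 * u) (h2v : u ≠ 2 * v)
    (hV : excess S {0, u, v} ≤ c)
    (hVV : excess S {0, u, v, 2 * u, 2 * v, u + v} ≤ c) : False := by
  have key : ∀ u v : ZMod p, u ≠ 0 → v ≠ 0 → u ≠ v → u ≠ 2 * v →
      excess S {0, u, v} ≤ c → excess S {0, u, v, 2 * u, 2 * v, u + v} ≤ c →
      u = 3 * v ∨ 2 * u = 3 * v := fun u v hu hv huv h2v hV hVV =>
    eq_of_three_mul_mem hp hv huv h2v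
      (three_mul_mem_of_triangle hlow hpair hroom hu hV hVV)
  have hsw1 : ({0, v, u} : Finset (ZMod p)) = {0, u, v} := by rw [Finset.pair_comm v u]
  have hsw2 : ({0, v, u, 2 * v, 2 * u, v + u} : Finset (ZMod p)) =
      {0, u, v, 2 * u, 2 * v, u + v} := by
    rw [insert_comm v u, insert_comm (2 * v) (2 * u), add_comm v u]
  have e1 : ∀ {x : ZMod p} (k : ℕ), 0 < k → k < 12 → (k : ZMod p) * x = 0 → x = 0 :=
    fun k h0 hk => eq_zero_of_natCast_mul h0 (by omega)
  rcases key u v hu hv huv h2v hV hVV with h | h <;>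
    rcases key v u hv hu huv.symm h2u (by rwa [hsw1]) (by rwa [hsw2]) with h' | h'
  · exact hv (e1 8 (by omega) (by omega) (by push_cast; linear_combination -h' - 3 * h))
  · exact hv (e1 7 (by omega) (by omega) (by push_cast; linear_combination -h' - 3 * h))
  · exact hu (e1 7 (by omega) (by omega) (by push_cast; linear_combination -h - 3 * h'))
  · exact hu (e1 5 (by omega) (by omega) (by push_cast; linear_combination -2 * h - 3 * h'))

/-! ### Additive energy of sets with small overlaps -/

/-- The additive energy, counted by the second pair of summands. -/
lemma addEnergy_eq_sum_card_inter (A B : Finset (ZMod p)) :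
    A.addEnergy B = ∑ b ∈ B ×ˢ B, (A ∩ (A + {b.2 - b.1})).card := by
  rw [addEnergy, ← card_sigma]
  refine card_bij (fun x _ => ⟨x.2, x.1.1⟩) ?_ ?_ ?_
  · rintro ⟨⟨a, a'⟩, b, b'⟩ h
    simp only [mem_filter, mem_product] at h
    simp only [mem_sigma, mem_product, mem_inter, mem_add_singleton]
    refine ⟨h.1.2, h.1.1.1, ?_⟩
    rw [show a - (b' - b) = a' by linear_combination h.2]
    exact h.1.1.2
  · rintro ⟨⟨a, a'⟩, b, b'⟩ h ⟨⟨a₂, a₂'⟩, b₂, b₂'⟩ h₂ he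
    simp only [mem_filter, mem_product] at h h₂
    simp only [Sigma.mk.injEq, Prod.mk.injEq, heq_eq_eq] at he
    obtain ⟨⟨rfl, rfl⟩, rfl⟩ := he
    have : a' = a₂' := by linear_combination h₂.2 - h.2
    rw [this]
  · rintro ⟨⟨b, b'⟩, a⟩ h
    simp only [mem_sigma, mem_product, mem_inter, mem_add_singleton] at h
    refine ⟨⟨⟨a, a - (b' - b)⟩, b, b'⟩, ?_, rfl⟩
    simp only [mem_filter, mem_product]
    exact ⟨⟨⟨h.2.1, h.2.2⟩, h.1⟩, by ring⟩

lemma sum_card_inter_eq (A B : Finset (ZMod p)) :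
    ∑ b ∈ B ×ˢ B, (A ∩ (A + {b.2 - b.1})).card =
      A.card * B.card + ∑ b ∈ B.offDiag, (A ∩ (A + {b.2 - b.1})).card := by
  rw [← diag_union_offDiag, sum_union (disjoint_diag_offDiag B), sum_diag]
  simp only [sub_self, singleton_zero, add_zero, inter_self, sum_const, smul_eq_mul, mul_comm]

lemma addEnergy_le {A B : Finset (ZMod p)} {μ : ℕ} (h : ∀ t ≠ 0, (A ∩ (A + {t})).card ≤ μ) :
    A.addEnergy B ≤ A.card * B.card + μ * (B.card * (B.card - 1)) := by
  rw [addEnergy_eq_sum_card_inter, sum_card_inter_eq]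
  refine Nat.add_le_add_left ?_ _
  have : ∑ b ∈ B.offDiag, (A ∩ (A + {b.2 - b.1})).card ≤ B.offDiag.card • μ := by
    apply sum_le_card_nsmul
    intro b hb
    rw [mem_offDiag] at hb
    exact h _ (sub_ne_zero.2 (Ne.symm hb.2.2))
  rw [offDiag_card, smul_eq_mul] at this
  rwa [Nat.mul_sub, mul_one, mul_comm μ]

lemma card_sq_mul_card_sq_le {A B : Finset (ZMod p)} {μ ν : ℕ}
    (hA : ∀ t ≠ 0, (A ∩ (A + {t})).card ≤ μ) (hB : ∀ t ≠ 0, (B ∩ (B + {t})).card ≤ ν) :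
    A.card ^ 2 * B.card ^ 2 ≤ (A + B).card * (A.card * B.card + μ * (B.card * (B.card - 1))) ∧
    A.card ^ 2 * B.card ^ 2 ≤ (A + B).card * (A.card * B.card + ν * (A.card * (A.card - 1))) := by
  have h := le_card_add_mul_addEnergy A B
  refine ⟨h.trans (Nat.mul_le_mul_left _ (addEnergy_le hA)), h.trans (Nat.mul_le_mul_left _ ?_)⟩
  rw [addEnergy_comm, mul_comm A.card]
  exact addEnergy_le hB

/-- Two Sidon sets whose sumset has at most as many elements as the two sets together are small: the
sumset of Sidon sets has few coincidences. -/
lemma card_le_three_of_card_add_le {B E : Finset (ZMod p)} (hB2 : 2 ≤ B.card) (hE2 : 2 ≤ E.card)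
    (hBsid : ∀ t ≠ 0, (B ∩ (B + {t})).card ≤ 1) (hEsid : ∀ t ≠ 0, (E ∩ (E + {t})).card ≤ 1)
    (hEc : (E + B).card ≤ E.card + B.card) : B.card ≤ 3 := by
  obtain ⟨h1, h2⟩ := card_sq_mul_card_sq_le hEsid hBsid
  generalize hb : B.card = b at *
  generalize he : E.card = e at *
  obtain ⟨b, rfl⟩ := Nat.exists_eq_add_of_le hB2
  obtain ⟨e, rfl⟩ := Nat.exists_eq_add_of_le hE2
  replace h1 := h1.trans (Nat.mul_le_mul_right _ hEc)
  replace h2 := h2.trans (Nat.mul_le_mul_right _ hEc)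
  have s1 : (2 + e) ^ 2 * (2 + b) ≤ (2 + e + (2 + b)) * (e + b + 3) := by
    refine Nat.le_of_mul_le_mul_right (c := 2 + b) ?_ (by omega)
    rw [show 2 + b - 1 = b + 1 by omega] at h1
    calc _ = (2 + e) ^ 2 * (2 + b) ^ 2 := by ring
      _ ≤ _ := h1
      _ = _ := by ring
  have s2 : (2 + b) ^ 2 * (2 + e) ≤ (2 + e + (2 + b)) * (e + b + 3) := by
    refine Nat.le_of_mul_le_mul_right (c := 2 + e) ?_ (by omega)
    rw [show 2 + e - 1 = e + 1 by omega] at h2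
    calc _ = (2 + e) ^ 2 * (2 + b) ^ 2 := by ring
      _ ≤ _ := h2
      _ = _ := by ring
  by_contra! hcon
  obtain ⟨b, rfl⟩ := Nat.exists_eq_add_of_le (show 2 ≤ b by omega)
  nlinarith [Nat.zero_le (b * e), Nat.zero_le (b * e * e), Nat.zero_le (b * b * e),
    Nat.zero_le (b * b), Nat.zero_le (e * e)]

lemma triangle_union_translates (u v : ZMod p) :
    ({0, u, v} ∪ ({0, u, v} + {u})) ∪ ({0, u, v} + {v}) =
      ({0, u, v, 2 * u, 2 * v, u + v} : Finset (ZMod p)) := by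
  simp only [insert_eq, union_add, singleton_add_singleton, zero_add, add_comm v u, ← two_mul]
  ext x
  simp only [mem_union, mem_singleton]
  constructor
  · rintro (((h | h | h) | (h | h | h)) | (h | h | h)) <;> simp [h]
  · rintro (h | h | h | h | h | h) <;> simp [h]

lemma triangle_inter_translate {u v : ZMod p} (hp : 2 < p) (hv : v ≠ 0) (huv : u ≠ v)
    (h2v : u ≠ 2 * v) :
    ({0, u, v} ∪ ({0, u, v} + {u})) ∩ ({0, u, v} + {v}) = ({0, u} + {v} : Finset (ZMod p)) := by
  ext x
  simp only [mem_inter, mem_union, mem_add_singleton, mem_insert, mem_singleton]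
  constructor
  · rintro ⟨hx, h | h | h⟩
    · exact Or.inl h
    · exact Or.inr h
    · exfalso
      rcases hx with (h' | h' | h') | (h' | h' | h')
      · exact hv (eq_zero_of_natCast_mul (k := 2) (by omega) hp
          (by push_cast; linear_combination h' - h))
      · exact h2v (by linear_combination h - h')
      · exact hv (by linear_combination h' - h)
      · exact h2v (by linear_combination h - h')
      · exact huv (sub_eq_zero.1 (eq_zero_of_natCast_mul (k := 2) (by omega) hp
          (by push_cast; linear_combination h - h')))
      · exact huv (by linear_combination h - h')
  · rintro (h | h)
    · exact ⟨Or.inl (Or.inr (Or.inr (by linear_combination h))), Or.inl h⟩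
    · exact ⟨Or.inr (Or.inr (Or.inr (by linear_combination h))), Or.inr (Or.inl h)⟩

/-- If `κ₂(S) ≤ |S|`, the minimum is attained by a set with two elements: an energy estimate for a
`2`-atom `B` of `S` and a `2`-atom of `B` bounds `|B|` by `3`, and triangles are impossible. -/
lemma exists_excess_pair_eq {S : Finset (ZMod p)} (hS : 2 ≤ S.card) (hk : kappa 2 S ≤ S.card)
    (hp : S.card + 20 ≤ p) : ∃ d ≠ 0, excess S {0, d} = kappa 2 S := by
  have hSne : S.Nonempty := card_pos.1 (by omega)
  obtain ⟨B, hB⟩ := exists_isAtom (k := 2) (S := S) (by omega)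
  have hB2 := hB.le_card
  have hBne : B.Nonempty := card_pos.1 (by omega)
  have hBS := hB.card_add_le
  have hBe := hB.excess_eq
  have hcd := le_excess_of_lt hSne hBne (by omega)
  have hBsid : ∀ t ≠ 0, (B ∩ (B + {t})).card ≤ 1 := fun t ht =>
    Nat.lt_succ_iff.1 (hB.card_inter_lt hSne (by omega) ht)
  have hkB : kappa 2 B ≤ B.card := by
    have := kappa_le_excess (k := 2) (S := B) (Z := S) hS (by rwa [add_comm S])
    have h2 := excess_comm B S
    omega
  have hdual := hB.card_add_card_add_le
  have hcS := card_add_eq S B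
  obtain ⟨E, hE⟩ := exists_isAtom (k := 2) (S := B) (by omega)
  have hE2 := hE.le_card
  have hEsid : ∀ t ≠ 0, (E ∩ (E + {t})).card ≤ 1 := fun t ht =>
    Nat.lt_succ_iff.1 (hE.card_inter_lt hBne (by omega) ht)
  have hEc : (E + B).card ≤ E.card + B.card := by
    have := card_add_eq B E
    have := hE.excess_eq
    omega
  have hb3 : B.card ≤ 3 := card_le_three_of_card_add_le hB2 hE2 hBsid hEsid hEc
  by_contra! hcon
  have hpair : ∀ f : ZMod p, f ≠ 0 → kappa 2 S + 1 ≤ excess S {0, f} := by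
    intro f hf
    have h2 := card_add_eq S {0, f}
    rw [card_pair hf.symm] at h2
    by_cases h : ({0, f} + S : Finset (ZMod p)).card + 2 ≤ p
    · have h3 := kappa_le_excess (card_pair hf.symm).ge h
      have h4 := hcon f hf
      omega
    · omega
  have hlow : ∀ Z : Finset (ZMod p), 2 ≤ Z.card → (Z + S).card + 2 ≤ p →
      kappa 2 S ≤ excess S Z := fun Z h1 h2 => kappa_le_excess h1 h2
  have hb : B.card = 3 := by
    by_contra hne
    obtain ⟨d, hd, t, ht⟩ := exists_eq_pair_add (show B.card = 2 by omega)
    rw [ht, excess_add_singleton] at hBe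
    exact hcon d hd hBe
  obtain ⟨u, v, t, hu, hv, huv, rfl⟩ := exists_eq_triple_add hb
  simp only [card_inter_translate_add] at hBsid
  obtain ⟨h2u, h2v⟩ := sidon_triple_ne hu hv huv hBsid
  rw [excess_add_singleton] at hBe
  rw [card_add_singleton] at hb
  rw [add_right_comm, card_add_singleton] at hcS hBS
  rw [card_add_singleton] at hcS
  -- the double of the triangle is built from three translates
  have h1 := excess_union_add_excess_inter_le S {0, u, v} ({0, u, v} + {u})
  rw [excess_add_singleton, hBe] at h1
  have h2 : (S.card : ℤ) - 1 ≤ excess S ({0, u, v} ∩ ({0, u, v} + {u})) := by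
    refine le_excess_of_lt hSne ⟨u, by simp [mem_add_singleton]⟩ ?_
    exact (card_le_card (add_subset_add_right inter_subset_left)).trans_lt (by omega)
  have h3 := excess_union_add_excess_inter_le S ({0, u, v} ∪ ({0, u, v} + {u}))
    ({0, u, v} + {v})
  rw [excess_add_singleton, hBe] at h3
  rw [triangle_inter_translate (by omega) hv huv h2v, triangle_union_translates,
    excess_add_singleton] at h3
  have h6 := hpair u hu
  have h7 : ({0, u, v, 2 * u, 2 * v, u + v} : Finset (ZMod p)).card ≤ 6 := card_le_six
  have h8 := card_add_eq S {0, u, v, 2 * u, 2 * v, u + v}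
  have h9 := le_excess_of_lt hSne (Z := {0, u, v, 2 * u, 2 * v, u + v}) ⟨0, by simp⟩ (by omega)
  exact false_of_triangle hlow hpair (by omega) (by omega) hu hv huv h2u h2v hBe.le (by omega)

/-! ### Sets contained in short progressions -/

lemma add_subset_inter_translate (S W : Finset (ZMod p)) (d : ZMod p) :
    (W ∩ (W + {d})) + S ⊆ (W + S) ∩ ((W + S) + {d}) := by
  refine subset_inter (add_subset_add_right inter_subset_left) ?_
  rw [add_right_comm]
  exact add_subset_add_right inter_subset_right

lemma inter_translate_subset {U W : Finset (ZMod p)} (h : U ⊆ W) (d : ZMod p) :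
    U ∩ (U + {d}) ⊆ W ∩ (W + {d}) :=
  inter_subset_inter h (add_subset_add_right h)

lemma le_excess_inter_translate {S W : Finset (ZMod p)} {d : ZMod p} {N : ℕ} (hd : d ≠ 0)
    (hS : S.Nonempty)
    (hlow : ∀ Z : Finset (ZMod p), 2 ≤ Z.card → (Z + S).card + 2 ≤ p → (N : ℤ) ≤ excess S Z)
    (he : excess S W ≤ N) (hI : 2 ≤ (W ∩ (W + {d})).card) (hroom : W.card + N < p) :
    (N : ℤ) ≤ excess S (W ∩ (W + {d})) := by
  have h1 := card_add_eq S W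
  have h2 : W.Nonempty := (card_pos.1 (by omega : 0 < (W ∩ (W + {d})).card)).mono inter_subset_left
  have h3 := card_inter_translate_lt hd (Z := W + S) (by omega) (h2.add hS)
  have h4 := card_le_card (add_subset_inter_translate S W d)
  exact hlow _ hI (by omega)

/-- If `N` is the minimal excess and `W` has excess `N` and meets `W + d` in at least two points,
then `S` is, after multiplication by a number at most that of the runs of `W`, contained in a
progression with difference `d` and `N + 1` terms. Either the runs of `W + S` can be matched with
the long gaps of `W`, or closing the short gaps of `W` produces a set with fewer runs. -/
lemma exists_forall_natCast_mul_eq {S : Finset (ZMod p)} {d : ZMod p} {N : ℕ} (hd : d ≠ 0)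
    (hS : S.Nonempty)
    (hlow : ∀ Z : Finset (ZMod p), 2 ≤ Z.card → (Z + S).card + 2 ≤ p → (N : ℤ) ≤ excess S Z)
    (r : ℕ) (W : Finset (ZMod p)) (he : excess S W ≤ N) (hI : 2 ≤ (W ∩ (W + {d})).card)
    (hr : (ends d W).card ≤ r) (hroom : W.card + N * ∑ i ∈ range (r + 1), i < p) :
    ∃ q, 1 ≤ q ∧ q ≤ r ∧ ∃ c, ∀ a ∈ S, ∃ i ≤ N, (q : ZMod p) * a = c - i * d := by
  induction r generalizing W with
  | zero =>
    have hW : W.Nonempty :=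
      (card_pos.1 (by omega : 0 < (W ∩ (W + {d})).card)).mono inter_subset_left
    have := ends_nonempty hd (by omega) hW
    omega
  | succ r ih =>
    rw [sum_range_succ, Nat.mul_add] at hroom
    have hN : N * 1 ≤ N * (r + 1) := Nat.mul_le_mul_left N (by omega)
    have hW : W.Nonempty :=
      (card_pos.1 (by omega : 0 < (W ∩ (W + {d})).card)).mono inter_subset_left
    have h1 := le_excess_inter_translate hd hS hlow he hI (by omega)
    have h2 := excess_grow_add_excess_inter_le S W d
    have h3 := excess_grow S W d
    have h4 := card_add_eq S W
    have h5 : (N : ℤ) ≤ excess S W := by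
      by_contra hcon
      have h6 := hlow W (hI.trans (card_le_card inter_subset_left)) (by omega)
      omega
    -- growing `W` by one step does not increase the excess, so `W + S` has no more runs than `W`
    have hends : (ends d (W + S)).card ≤ (ends d W).card := by omega
    have hcard := card_iterate_grow_le d W N
    have hmul : N * (ends d W).card ≤ N * (r + 1) := Nat.mul_le_mul_left N hr
    have hlong := card_longEnds d N W
    have hpos : 0 < (ends d ((grow d)^[N] W)).card :=
      ends_nonempty hd (by omega) (hW.mono (subset_iterate_grow d W (Nat.zero_le N)))
    have hanti := ends_iterate_card_anti d W (Nat.zero_le N)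
    simp only [Function.iterate_zero, id] at hanti
    by_cases hc : (ends d (W + S)).card ≤ (longEnds d N W).card
    · obtain ⟨c, hc⟩ := exists_forall_card_mul_eq (S := S) (W := W) (N := N) (by omega) hc
      exact ⟨_, by omega, by omega, c, hc⟩
    -- otherwise the short gaps are closed; the excess stays minimal along the way
    · have hr1 : 1 ≤ r := by omega
      have hsum : 1 ≤ ∑ i ∈ range (r + 1), i :=
        (show 1 ≤ r from hr1).trans (single_le_sum (f := fun i => i) (fun i _ => Nat.zero_le i)
          (mem_range.2 (Nat.lt_succ_self r)))
      have hNs : N * 1 ≤ N * ∑ i ∈ range (r + 1), i := Nat.mul_le_mul_left N hsum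
      have hmain : ∀ j ≤ N, excess S ((grow d)^[j] W) ≤ N ∧
          2 ≤ ((grow d)^[j] W ∩ ((grow d)^[j] W + {d})).card := by
        intro j
        induction j with
        | zero => exact fun _ => ⟨he, hI⟩
        | succ j ihj =>
          intro hj
          obtain ⟨i1, i2⟩ := ihj (by omega)
          have hc1 := card_iterate_grow_le d W j
          have hc2 : j * (ends d W).card ≤ N * (r + 1) := Nat.mul_le_mul (by omega) hr
          have i3 := le_excess_inter_translate hd hS hlow i1 i2 (by omega)
          have i4 := excess_grow_add_excess_inter_le S ((grow d)^[j] W) d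
          rw [Function.iterate_succ_apply']
          exact ⟨by omega, i2.trans (card_le_card (inter_translate_subset (subset_grow d _) d))⟩
      obtain ⟨m1, m2⟩ := hmain N le_rfl
      obtain ⟨q, hq1, hq2, hq⟩ := ih _ m1 m2 (by omega) (by omega)
      exact ⟨q, hq1, by omega, hq⟩

lemma subset_prog_of_forall_natCast_mul_eq {S : Finset (ZMod p)} {c d : ZMod p} {N q : ℕ}
    (hd : d ≠ 0) (hq : 1 ≤ q) (hqp : q < p)
    (h : ∀ a ∈ S, ∃ i ≤ N, (q : ZMod p) * a = c - i * d) :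
    ∃ δ ≠ 0, ∃ c', S ⊆ prog δ N + {c'} := by
  have hq0 : (q : ZMod p) ≠ 0 := by
    intro h0
    have := Nat.le_of_dvd hq ((ZMod.natCast_eq_zero_iff q p).1 h0)
    omega
  refine ⟨-(d / q), neg_ne_zero.2 (div_ne_zero hd hq0), c / q, fun a ha => ?_⟩
  obtain ⟨i, hi, he⟩ := h a ha
  rw [mem_add_singleton, mem_prog]
  refine ⟨i, hi, ?_⟩
  field_simp
  linear_combination he

lemma excess_prog_le {X : Finset (ZMod p)} {d : ZMod p} (hd : d ≠ 0) (hX : X.Nonempty) {i j : ℕ}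
    (hij : i ≤ j) (hj : j < p) (h : (prog d j + X).card < p) :
    excess X (prog d i) ≤ excess X (prog d j) := by
  induction j, hij using Nat.le_induction with
  | base => exact le_rfl
  | succ j hij ih =>
    have hs : prog d (j + 1) = grow d (prog d j) := Function.iterate_succ_apply' _ _ _
    have h1 : (prog d j + X).card < p := by
      refine (card_le_card (add_subset_add_right ?_)).trans_lt h
      rw [hs]
      exact subset_grow d _
    have h0 : (prog d j).Nonempty := ⟨0, mem_prog.2 ⟨0, Nat.zero_le _, by simp⟩⟩
    have h2 := ends_nonempty hd h1 (h0.add hX)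
    have h3 := excess_grow X (prog d j) d
    have h4 := card_grow d (prog d j)
    rw [← hs, card_prog hd hj, card_prog hd (by omega)] at h4
    have h5 := ih (by omega) h1
    rw [hs]
    omega

/-- A progression whose excess is at most `κ_k` can be shortened to `k` terms. -/
lemma IsAtom.false_of_excess_prog_le {k : ℕ} {X A : Finset (ZMod p)} (hA : IsAtom k X A)
    (hX : X.Nonempty) (hk : 1 ≤ k) (hkA : k < A.card) {d : ZMod p} (hd : d ≠ 0) {L : ℕ}
    (hkL : k ≤ L + 1) (hL : L < p) (hlt : (prog d L + X).card < p)
    (he : excess X (prog d L) ≤ kappa k X) : False := by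
  have h1 := excess_prog_le hd hX (show k - 1 ≤ L by omega) hL hlt
  have h2 := card_prog hd (show k - 1 < p by omega)
  have h3 := card_add_eq X (prog d (k - 1))
  have h4 := hA.card_add_le
  have h5 := card_add_eq X A
  have h6 := hA.excess_eq
  have := hA.kappa_lt_excess (Z := prog d (k - 1)) (by omega) (by omega) (by omega)
  omega

lemma iterate_grow_subset_prog {A : Finset (ZMod p)} {δ c : ZMod p} {L : ℕ}
    (h : A ⊆ prog δ L + {c}) (j : ℕ) : (grow δ)^[j] A ⊆ prog δ (L + j) + {c} := by
  intro x hx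
  obtain ⟨i, hi, hxi⟩ := mem_iterate_grow.1 hx
  obtain ⟨i', hi', he⟩ := mem_prog.1 (mem_add_singleton.1 (h hxi))
  rw [mem_add_singleton, mem_prog]
  refine ⟨i' + i, by omega, ?_⟩
  push_cast
  linear_combination he

/-- A set missing at most two terms of a progression becomes a long progression after three steps
of growth. -/
lemma prog_subset_iterate_grow {A : Finset (ZMod p)} {δ c : ZMod p} {m : ℕ} (hm : A.card = m)
    (hm1 : 1 ≤ m) (h : A ⊆ prog δ (m + 1) + {c}) : prog δ m + {c + 2 * δ} ⊆ (grow δ)^[3] A := by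
  classical
  set K := (range (m + 2)).filter fun i : ℕ => c + i * δ ∈ A with hK
  have hKm : m ≤ K.card := by
    rw [← hm]
    have : A ⊆ K.image fun i : ℕ => c + i * δ := by
      intro a ha
      obtain ⟨i, hi, he⟩ := mem_prog.1 (mem_add_singleton.1 (h ha))
      have he' : c + i * δ = a := by linear_combination -he
      refine mem_image.2 ⟨i, ?_, he'⟩
      rw [hK, mem_filter, mem_range, he']
      exact ⟨by omega, ha⟩
    exact (card_le_card this).trans card_image_le
  intro x hx
  obtain ⟨j, hj, he⟩ := mem_prog.1 (mem_add_singleton.1 hx)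
  -- the window of the last four positions contains three positions of the progression
  have hex : ∃ i ∈ K, i ≤ j + 2 ∧ j ≤ i + 1 := by
    by_contra! hcon
    have hsub : K ⊆ range (m + 2) \ Icc (min j (m - 1)) (min j (m - 1) + 2) := by
      intro i hi
      have h2 := hcon i hi
      have h3 := (mem_filter.1 hi).1
      rw [mem_sdiff, mem_Icc]
      exact ⟨h3, by omega⟩
    have h4 := card_le_card hsub
    rw [card_sdiff_of_subset, card_range, Nat.card_Icc] at h4
    · omega
    · intro i hi
      rw [mem_Icc] at hi
      rw [mem_range]
      omega
  obtain ⟨i, hiK, hi1, hi2⟩ := hex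
  rw [mem_iterate_grow]
  refine ⟨j + 2 - i, by omega, ?_⟩
  have := (mem_filter.1 hiK).2
  rw [Nat.cast_sub hi1]
  convert this using 1
  push_cast
  linear_combination he

/-- An atom with at least five and at most seven elements is not contained in a progression with two
more terms: `X` would have a gap of at least `|A| + 1` terms, so that some sum `a + x` would have
a single representation, and `a` could be removed. -/
lemma IsAtom.false_of_subset_prog {k : ℕ} {X A : Finset (ZMod p)} (hA : IsAtom k X A)
    (hX : X.Nonempty) (hkA : k < A.card) (h5 : 5 ≤ A.card) (h7 : A.card ≤ 7)
    (hkappa : kappa k X ≤ X.card + 1) (hp : X.card + 42 < p) {δ c : ZMod p} (hδ : δ ≠ 0)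
    (h : A ⊆ prog δ (A.card + 1) + {c}) : False := by
  classical
  have hXpos := hX.card_pos
  have hAne : A.Nonempty := card_pos.1 (by omega)
  have hcard : ∀ j ≤ 3, ((grow δ)^[j] A).card ≤ A.card + 2 + j := by
    intro j hj
    have := card_le_card (iterate_grow_subset_prog h j)
    rw [card_add_singleton, card_prog hδ (by omega)] at this
    omega
  have hI : 0 < (A ∩ (A + {δ})).card := by
    have h1 := card_inter_add_card_ends δ A
    have h2 := card_grow δ A
    have h3 := hcard 1 (by omega)
    rw [Function.iterate_one] at h3
    omega
  have hstep : ∀ B : Finset (ZMod p), A ⊆ B → (B + X).card < p →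
      excess X (grow δ B) ≤ 2 * excess X B - (X.card - 1) := by
    intro B hB hlt
    have h1 := excess_grow_add_excess_inter_le X B δ
    have h2 : ((B ∩ (B + {δ})) + X).card < p :=
      (card_le_card (add_subset_add_right inter_subset_left)).trans_lt hlt
    have h3 := le_excess_of_lt hX ((card_pos.1 hI).mono (inter_translate_subset hB δ)) h2
    omega
  have e0 := hA.excess_eq
  have c0 := hcard 0 (by omega)
  have a0 := card_add_eq X A
  have s1 := hstep A Subset.rfl (by have := hA.card_add_le; omega)
  have c1 := hcard 1 (by omega)
  have a1 := card_add_eq X (grow δ A)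
  rw [Function.iterate_one] at c1
  have s2 := hstep (grow δ A) (subset_grow δ A) (by omega)
  have c2 := hcard 2 (by omega)
  have a2 := card_add_eq X (grow δ (grow δ A))
  change (grow δ (grow δ A)).card ≤ _ at c2
  have s3 := hstep (grow δ (grow δ A)) ((subset_grow δ A).trans (subset_grow δ _)) (by omega)
  have c3 := hcard 3 le_rfl
  have a3 := card_add_eq X ((grow δ)^[3] A)
  change excess X ((grow δ)^[3] A) ≤ _ at s3
  have hprog := card_le_card (add_subset_add_right (t := X)
    (prog_subset_iterate_grow rfl (by omega) h))
  rw [add_right_comm, card_add_singleton, prog, iterate_grow_add, singleton_zero, zero_add] at hprog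
  -- growing `A` three times leaves `A + X` proper, so `X` has a gap of more than `|A|` terms
  have hpos := ends_nonempty hδ (Z := (grow δ)^[A.card] X) (by omega)
    (hX.mono (subset_iterate_grow δ X (Nat.zero_le _)))
  rw [← card_longEnds] at hpos
  obtain ⟨x, hx⟩ := card_pos.1 hpos
  rw [mem_longEnds] at hx
  have hidx : ∀ a ∈ A, ∃ i ≤ A.card + 1, a = c + (i : ℕ) * δ := by
    intro a ha
    obtain ⟨i, hi, he⟩ := mem_prog.1 (mem_add_singleton.1 (h ha))
    exact ⟨i, hi, by linear_combination he⟩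
  choose! idx hidx hidx' using hidx
  obtain ⟨a, haA, hmax⟩ := exists_max_image A idx hAne
  -- the sum of the last element `a` of `A` and the element `x` before the gap is unique
  have hsub : A.erase a + X ⊆ (A + X).erase (a + x) := by
    intro y hy
    obtain ⟨a', ha', x', hx', rfl⟩ := mem_add.1 hy
    obtain ⟨hne, ha'A⟩ := mem_erase.1 ha'
    refine mem_erase.2 ⟨fun he => ?_, add_mem_add ha'A hx'⟩
    have hle := hmax a' ha'A
    rcases Nat.eq_or_lt_of_le hle with hi | hi
    · apply hne
      rw [hidx' a' ha'A, hidx' a haA, hi]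
    · have hb := hidx a haA
      apply hx.2 (idx a - idx a') (by omega) (by omega)
      rw [Nat.cast_sub hle]
      convert hx' using 1
      have e1 := hidx' a' ha'A
      have e2 := hidx' a haA
      linear_combination -he + e1 - e2
  have h1 := card_le_card hsub
  rw [card_erase_of_mem (add_mem_add haA hx.1)] at h1
  have h2 := card_erase_of_mem haA
  have h3 := card_add_eq X (A.erase a)
  have h4 := hA.card_add_le
  have := hA.kappa_lt_excess (Z := A.erase a) (by omega) (by omega) (by omega)
  omega

/-! ### Atoms with two runs -/

lemma card_add_mul_le_card_iterate_grow {d : ZMod p} {Z : Finset (ZMod p)} {r L : ℕ}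
    (h : r ≤ (ends d ((grow d)^[L] Z)).card) : Z.card + L * r ≤ ((grow d)^[L] Z).card := by
  induction L with
  | zero => simp
  | succ L ih =>
    have h1 := ends_iterate_card_anti d Z (show L ≤ L + 1 by omega)
    have h2 := ih (h.trans h1)
    rw [Function.iterate_succ_apply', card_grow, Nat.succ_mul]
    omega

/-- A set missing one term of a progression becomes a progression after one step of growth. -/
lemma ends_grow_le_one {C : Finset (ZMod p)} {δ c' : ZMod p} {c : ℕ} (hδ : δ ≠ 0) (hcp : c + 1 < p)
    (hc : C.card = c) (h : C ⊆ prog δ c + {c'}) : (ends δ (grow δ C)).card ≤ 1 := by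
  have hPC : ((prog δ c + {c'}) \ C).card ≤ 1 := by
    rw [card_sdiff_of_subset h, card_add_singleton, card_prog hδ (by omega)]
    omega
  have hmem : ∀ i ≤ c, c' + (i : ℕ) * δ ∈ prog δ c + {c'} := fun i hi =>
    mem_add_singleton.2 (mem_prog.2 ⟨i, hi, by ring⟩)
  have key : ∀ z ∈ ends δ (grow δ C), (z = c' + c * δ ∧ c' + c * δ ∉ C) ∨
      (z = c' + (c + 1) * δ ∧ c' + c * δ ∈ C) := by
    intro z hz
    simp only [mem_ends, mem_grow, add_sub_cancel_right, not_or] at hz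
    obtain ⟨hz1, hz2, hz3⟩ := hz
    have hzC : z - δ ∈ C := hz1.resolve_left hz3
    obtain ⟨i, hi, he⟩ := mem_prog.1 (mem_add_singleton.1 (h hzC))
    have hzi : z = c' + ((i + 1 : ℕ) : ZMod p) * δ := by
      push_cast
      linear_combination he
    rcases Nat.lt_or_ge (i + 1) c with hlt | hge
    · exfalso
      have h1 : z ∈ (prog δ c + {c'}) \ C := mem_sdiff.2 ⟨hzi ▸ hmem (i + 1) (by omega), hz3⟩
      have h2 : z + δ ∈ (prog δ c + {c'}) \ C := by
        refine mem_sdiff.2 ⟨?_, hz2⟩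
        convert hmem (i + 2) (by omega) using 1
        rw [hzi]
        push_cast
        ring
      exact hδ (left_eq_add.1 (card_le_one.1 hPC _ h1 _ h2))
    · rcases Nat.eq_or_lt_of_le hi with hic | hic
      · right
        rw [← hic]
        refine ⟨by rw [hzi]; push_cast; ring, ?_⟩
        convert hzC using 1
        linear_combination -he
      · left
        have : i + 1 = c := by omega
        rw [← this]
        exact ⟨hzi, hzi ▸ hz3⟩
  rw [card_le_one]
  intro a ha b hb
  rcases key a ha with ⟨h1, h2⟩ | ⟨h1, h2⟩ <;> rcases key b hb with ⟨h3, h4⟩ | ⟨h3, h4⟩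
  · rw [h1, h3]
  · exact absurd h4 h2
  · exact absurd h2 h4
  · rw [h1, h3]

lemma excess_prog_le_of_ends_le_one {X : Finset (ZMod p)} {d : ZMod p} (hd : d ≠ 0) {L : ℕ}
    (hL : L < p) (h : (ends d X).card ≤ 1) : excess X (prog d L) ≤ X.card - 1 := by
  have h1 : prog d L + X = (grow d)^[L] X := by
    rw [prog, iterate_grow_add, singleton_zero, zero_add]
  have h2 := card_iterate_grow_le d X L
  have h3 := Nat.mul_le_mul_left L h
  rw [excess, h1, card_prog hd hL]
  omega

/-- If the intersection of an atom with its translate had smaller excess than the atom, it would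
be almost a progression, and so produce a progression that is a fragment. -/
lemma IsAtom.kappa_le_excess_inter {k : ℕ} {X A : Finset (ZMod p)} (hA : IsAtom k X A)
    (hk4 : 4 ≤ k) (hk5 : k ≤ 5) (hX : 4 ≤ X.card) (hp : X.card + 42 < p)
    (hkappa : kappa k X ≤ X.card + 1) (hm : A.card = k + 1) {d : ZMod p}
    (hI : (A ∩ (A + {d})).card + 1 = k) : kappa k X ≤ excess X (A ∩ (A + {d})) := by
  by_contra! hcon
  have hXne : X.Nonempty := card_pos.1 (by omega)
  have hAX := hA.card_add_le
  have hAne : A.Nonempty := card_pos.1 (by omega)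
  have hcd := le_excess_of_lt hXne hAne (by omega)
  rw [hA.excess_eq] at hcd
  set C := A ∩ (A + {d}) with hC
  have hCne : C.Nonempty := card_pos.1 (by omega)
  have hCX : (C + X).card ≤ (A + X).card := card_le_card (add_subset_add_right inter_subset_left)
  have h2 := kappa_le_excess (k := 2) (S := X) (Z := C) (by omega) (by omega)
  obtain ⟨e, he, hpair⟩ := exists_excess_pair_eq (S := X) (by omega) (by omega) (by omega)
  rw [excess_pair X he] at hpair
  have hends : (ends e X).card = 2 := by
    by_contra hne
    have h1 := excess_prog_le_of_ends_le_one (L := k - 1) he (by omega) (X := X) (by omega)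
    have h3 := card_add_eq X (prog e (k - 1))
    rw [card_prog he (by omega)] at h3
    exact hA.false_of_excess_prog_le hXne (by omega) (by omega) he (L := k - 1) (by omega)
      (by omega) (by omega) (by omega)
  have hCe : excess X C = X.card := by omega
  have hCX' : excess C X = C.card := by
    rw [excess_comm, hCe]
    ring
  have hXC := kappa_le_excess (k := 2) (S := C) (Z := X) (by omega) (by rw [add_comm X]; omega)
  -- by now `X` has excess `|C|` with respect to `C`, and two runs with difference `e`
  have hsub : ∃ δ ≠ 0, ∃ c', C ⊆ prog δ C.card + {c'} := by
    by_cases hlt : kappa 2 C < C.card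
    · obtain ⟨f, hf, hpf⟩ := exists_excess_pair_eq (S := C) (by omega) (by omega) (by omega)
      rw [excess_pair C hf] at hpf
      obtain ⟨z, L, hL, hz⟩ := exists_eq_prog hf (Z := C) (by omega) hCne (by omega)
      refine ⟨f, hf, z, ?_⟩
      conv_lhs => rw [hz]
      exact add_subset_add_right (subset_iterate_grow f {0} (by omega))
    · have hinter := card_inter_add_card_ends e X
      have hsum : ∑ i ∈ range (2 + 1), i = 3 := rfl
      obtain ⟨q, hq1, hq2, c, hc⟩ := exists_forall_natCast_mul_eq (S := C) (N := C.card) he hCne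
        (fun Z h1 h2 => by have := kappa_le_excess h1 h2; omega) 2 X (by omega) (by omega)
        (by omega) (by rw [hsum]; omega)
      exact subset_prog_of_forall_natCast_mul_eq he hq1 (by omega) hc
  obtain ⟨δ, hδ, c', hsub⟩ := hsub
  have h1 := ends_grow_le_one hδ (by omega) rfl hsub
  have h3 := card_grow δ C
  have h4 := ends_nonempty hδ (Z := C) (by omega) hCne
  have h5 := card_le_card (iterate_grow_subset_prog hsub 1)
  rw [Function.iterate_one, card_add_singleton, card_prog hδ (by omega)] at h5
  have h6 := card_inter_add_card_ends δ C
  have h7 := excess_grow_add_excess_inter_le X C δ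
  have h8 := le_excess_of_lt hXne (Z := C ∩ (C + {δ})) (card_pos.1 (by omega))
    ((card_le_card (add_subset_add_right inter_subset_left)).trans_lt
      (show (C + X).card < p by omega))
  have h9 := card_add_eq X (grow δ C)
  obtain ⟨z, L, hL, hz⟩ := exists_eq_prog hδ (Z := grow δ C) (by omega)
    (hCne.mono (subset_grow δ C)) h1
  rw [hz, excess_add_singleton, add_right_comm, card_add_singleton, card_add_singleton] at h9
  rw [hz, excess_add_singleton] at h7
  rw [hz, card_add_singleton] at h3 hL
  exact hA.false_of_excess_prog_le hXne (by omega) (by omega) hδ (L := L) (by omega)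
    (by omega) (by omega) (by omega)

/-- Growing the atom along its two runs keeps the excess and, until it becomes a progression, the
two runs. Matching them with the gaps of `X` puts the atom into a short progression, unless `X`
has only one long gap; in that case the sizes do not fit. -/
lemma IsAtom.false_of_ends_le_two {k : ℕ} {X A : Finset (ZMod p)} (hA : IsAtom k X A)
    (hk4 : 4 ≤ k) (hk5 : k ≤ 5) (hX : 4 ≤ X.card) (hp : X.card + 42 < p)
    (hkappa : kappa k X ≤ X.card + 1) (hm : A.card = k + 1) {d : ZMod p} (hd : d ≠ 0)
    (hends : (ends d A).card ≤ 2) : False := by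
  have hXne : X.Nonempty := card_pos.1 (by omega)
  have hAX := hA.card_add_le
  have hAne : A.Nonempty := card_pos.1 (by omega)
  have hAe := hA.excess_eq
  have hcd := le_excess_of_lt hXne hAne (by omega)
  have hI := card_inter_add_card_ends d A
  have hI' := hA.card_inter_lt hXne (by omega) hd
  have hkI := hA.kappa_le_excess_inter hk4 hk5 hX hp hkappa hm (d := d) (by omega)
  -- `N` is the excess of `X` with respect to `A`, which the matching of gaps refers to
  obtain ⟨N, hN⟩ : ∃ N : ℕ, (N : ℤ) = A.card + kappa k X - X.card :=
    ⟨(A.card + kappa k X - X.card).toNat, Int.toNat_of_nonneg (by omega)⟩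
  have hcard : ∀ j ≤ N + 1, ((grow d)^[j] A).card ≤ A.card + 2 * j ∧
      A.card ≤ ((grow d)^[j] A).card := by
    intro j hj
    have h1 := card_iterate_grow_le d A j
    have h2 := Nat.mul_le_mul_left j hends
    exact ⟨by omega, card_le_card (subset_iterate_grow d A (Nat.zero_le j))⟩
  have hexc : ∀ j ≤ N + 1, excess X ((grow d)^[j] A) = kappa k X := by
    intro j hj
    refine le_antisymm ?_ ?_
    · induction j with
      | zero => exact hAe.le
      | succ j ih =>
        have h1 := ih (by omega)
        have h2 := hcard j (by omega)
        have h3 := excess_grow_add_excess_inter_le X ((grow d)^[j] A) d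
        have h4 := card_add_eq X ((grow d)^[j] A)
        rw [Function.iterate_succ_apply']
        suffices kappa k X ≤ excess X ((grow d)^[j] A ∩ ((grow d)^[j] A + {d})) by omega
        rcases j with _ | j
        · exact hkI
        · have hsub : A + {d} ⊆ (grow d)^[j + 1] A ∩ ((grow d)^[j + 1] A + {d}) := by
            have h0 := subset_iterate_grow d A (Nat.zero_le (j + 1))
            refine subset_inter ?_ (add_subset_add_right h0)
            refine Subset.trans ?_ (subset_iterate_grow d A (show 1 ≤ j + 1 by omega))
            rw [Function.iterate_one, grow_eq_union]
            exact subset_union_right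
          have h5 := card_le_card hsub
          rw [card_add_singleton] at h5
          have h6 : (((grow d)^[j + 1] A ∩ ((grow d)^[j + 1] A + {d})) + X).card ≤
            ((grow d)^[j + 1] A + X).card := card_le_card (add_subset_add_right inter_subset_left)
          exact kappa_le_excess (by omega) (by omega)
    · have h2 := hcard j hj
      by_contra! hcon
      have h4 := card_add_eq X ((grow d)^[j] A)
      have := kappa_le_excess (k := k) (S := X) (Z := (grow d)^[j] A) (by omega) (by omega)
      omega
  have hendsX : ∀ j ≤ N, (ends d ((grow d)^[j] A + X)).card = (ends d ((grow d)^[j] A)).card := by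
    intro j hj
    have h1 := excess_grow X ((grow d)^[j] A) d
    rw [← Function.iterate_succ_apply' (grow d), hexc (j + 1) (by omega), hexc j (by omega)] at h1
    omega
  have hcN := hcard N (by omega)
  have hAN := card_add_eq X ((grow d)^[N] A)
  rw [hexc N (by omega)] at hAN
  have htwo : 2 ≤ (ends d ((grow d)^[N] A)).card := by
    by_contra! hlt
    obtain ⟨z, L, hL, hz⟩ := exists_eq_prog hd (Z := (grow d)^[N] A) (by omega)
      (card_pos.1 (by omega)) (by omega)
    have h1 := hexc N (by omega)
    rw [hz, excess_add_singleton] at h1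
    rw [hz, add_right_comm, card_add_singleton, card_add_singleton] at hAN
    rw [hz, card_add_singleton] at hcN hL
    exact hA.false_of_excess_prog_le hXne (by omega) (by omega) hd (L := L) (by omega)
      (by omega) (by omega) h1.le
  have hends0 := hendsX 0 (Nat.zero_le N)
  simp only [Function.iterate_zero, id] at hends0
  have hA0 := card_add_eq X A
  by_cases hlong : 2 ≤ (longEnds d N X).card
  · obtain ⟨c, hc⟩ := exists_forall_card_mul_eq (S := A) (W := X) (d := d) (N := N)
      (by rw [add_comm X]; omega) (by rw [add_comm X]; omega)
    have hle : (longEnds d N X).card ≤ X.card :=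
      card_le_card fun w hw => (mem_longEnds.1 hw).1
    obtain ⟨δ, hδ, c', hsub⟩ := subset_prog_of_forall_natCast_mul_eq hd (by omega) (by omega) hc
    exact hA.false_of_subset_prog hXne (by omega) (by omega) (by omega) hkappa hp hδ
      (hsub.trans (add_subset_add_right (subset_iterate_grow δ {0} (by omega))))
  -- otherwise `N` steps of growth turn `X` into a progression, so that `A + X` grown `N` times is a
  -- translate of `A` grown `L` times, and the two counts of its elements disagree
  · rw [card_longEnds] at hlong
    have hcomm : A + (grow d)^[N] X = (grow d)^[N] A + X := by
      rw [add_comm, iterate_grow_add, add_comm X, iterate_grow_add]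
    have hXN : ((grow d)^[N] X).card ≤ (A + (grow d)^[N] X).card := card_le_card_add_left hAne
    rw [hcomm] at hXN
    have hXNne := hXne.mono (subset_iterate_grow d X (Nat.zero_le N))
    have h1 := ends_nonempty hd (Z := (grow d)^[N] X) (by omega) hXNne
    have h2 := card_add_mul_le_card_iterate_grow (Z := X) (d := d) (r := 1) (L := N) (by omega)
    obtain ⟨z, L, hL, hz⟩ := exists_eq_prog hd (Z := (grow d)^[N] X) (by omega) hXNne (by omega)
    have hLA : A + (grow d)^[N] X = (grow d)^[L] A + {z} := by
      rw [hz, ← add_assoc, prog, add_comm A, iterate_grow_add, singleton_zero, zero_add]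
    have h3 := hendsX N le_rfl
    have h4 : ends d ((grow d)^[L] A + {z}) = ends d ((grow d)^[L] A) + {z} := by
      ext x
      rw [mem_add_singleton, mem_ends, mem_ends, mem_add_singleton, mem_add_singleton,
        sub_add_eq_add_sub]
    rw [← hcomm, hLA, h4, card_add_singleton] at h3
    have h5 := card_add_mul_le_card_iterate_grow (Z := A) (d := d) (r := 2) (L := L) (by omega)
    rw [← hcomm, hLA, card_add_singleton] at hAN
    omega

/-! ### Atoms with a large overlap -/

/-- The two energy bounds for a Sidon set with `b` elements and a set with `m` elements whose
translates overlap in at most `μ` points are incompatible when their sumset is that small. -/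
lemma energy_bound_false {m b μ : ℕ} (hm : 5 ≤ m) (hb : 3 ≤ b) (hμ3 : μ ≤ 3) (hμ : μ + 4 ≤ m)
    (h1 : b ^ 2 * m ^ 2 ≤ (b + m + 1) * (b * m + 1 * (m * (m - 1))))
    (h2 : b ^ 2 * m ^ 2 ≤ (b + m + 1) * (b * m + μ * (b * (b - 1)))) : False := by
  obtain ⟨x, rfl⟩ := Nat.exists_eq_add_of_le hm
  obtain ⟨y, rfl⟩ := Nat.exists_eq_add_of_le hb
  have s1 : (3 + y) ^ 2 * (5 + x) ≤ (3 + y + (5 + x) + 1) * (3 + y + (4 + x)) := by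
    refine Nat.le_of_mul_le_mul_right (c := 5 + x) ?_ (by omega)
    rw [show 5 + x - 1 = 4 + x by omega] at h1
    calc _ = (3 + y) ^ 2 * (5 + x) ^ 2 := by ring
      _ ≤ _ := h1
      _ = _ := by ring
  have s2 : (3 + y) * (5 + x) ^ 2 ≤ (3 + y + (5 + x) + 1) * (5 + x + μ * (2 + y)) := by
    refine Nat.le_of_mul_le_mul_right (c := 3 + y) ?_ (by omega)
    rw [show 3 + y - 1 = 2 + y by omega] at h2
    calc _ = (3 + y) ^ 2 * (5 + x) ^ 2 := by ring
      _ ≤ _ := h2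
      _ = _ := by ring
  have hyx : y ≤ x + 2 := by
    by_contra! hcon
    obtain ⟨z, rfl⟩ := Nat.exists_eq_add_of_le hcon.le
    nlinarith [Nat.zero_le (x * z), Nat.zero_le (x * x), Nat.zero_le (z * z),
      Nat.zero_le (x * z * z), Nat.zero_le (x * x * z), Nat.zero_le (x * x * x)]
  have hx : x ≤ 4 := by
    by_contra! hcon
    have s3 : (3 + y) * (5 + x) ^ 2 ≤ (3 + y + (5 + x) + 1) * (5 + x + 3 * (2 + y)) :=
      s2.trans (Nat.mul_le_mul_left _ (by nlinarith))
    obtain ⟨w, rfl⟩ := Nat.exists_eq_add_of_le hcon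
    nlinarith [Nat.mul_le_mul_left y hyx, Nat.mul_le_mul_left w hyx]
  interval_cases x <;> interval_cases μ <;> interval_cases y <;> omega

/-- A `2`-atom of a `4`-atom `A` either has two elements, or contradicts an energy estimate unless
some translate of `A` meets `A` in all but at most three points. -/
lemma IsAtom.exists_card_le_card_inter_add_three {X A : Finset (ZMod p)} (hA : IsAtom 4 X A)
    (hX : 2 ≤ X.card) (hp : X.card + 42 < p) (hkappa : kappa 4 X ≤ X.card + 1)
    (h5 : 5 ≤ A.card) : ∃ d ≠ 0, A.card ≤ (A ∩ (A + {d})).card + 3 := by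
  by_contra! hcon
  have hXne : X.Nonempty := card_pos.1 (by omega)
  have hAX := hA.card_add_le
  have hdual := hA.card_add_card_add_le
  have hAne : A.Nonempty := card_pos.1 (by omega)
  have h1 := kappa_le_excess (k := 2) (S := A) (Z := X) hX (by rw [add_comm X]; omega)
  rw [excess_comm, hA.excess_eq] at h1
  have hAS := card_add_eq X A
  have hAe := hA.excess_eq
  have hcd := le_excess_of_lt hXne hAne (by omega)
  obtain ⟨B, hB⟩ := exists_isAtom (k := 2) (S := A) (by omega)
  have hB2 := hB.le_card
  have hBsid : ∀ t ≠ 0, (B ∩ (B + {t})).card ≤ 1 := fun t ht =>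
    Nat.lt_succ_iff.1 (hB.card_inter_lt hAne (by omega) ht)
  have hBe := hB.excess_eq
  have hBc := card_add_eq A B
  rcases Nat.eq_or_lt_of_le hB2 with hb | hb
  · obtain ⟨d, hd, t, rfl⟩ := exists_eq_pair_add hb.symm
    rw [excess_add_singleton, excess_pair A hd] at hBe
    have h2 := card_inter_add_card_ends d A
    have h3 := hcon d hd
    omega
  · have hAμ : ∀ t ≠ 0, (A ∩ (A + {t})).card ≤ min 3 (A.card - 4) := by
      intro t ht
      have h2 := hA.card_inter_lt hXne (by omega) ht
      have h3 := hcon t ht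
      omega
    obtain ⟨e1, e2⟩ := card_sq_mul_card_sq_le hBsid hAμ
    have hle : (B + A).card ≤ B.card + A.card + 1 := by omega
    exact energy_bound_false h5 hb (μ := min 3 (A.card - 4)) (by omega) (by omega)
      (e1.trans (Nat.mul_le_mul_right _ hle)) (e2.trans (Nat.mul_le_mul_right _ hle))

/-- Every integer `r` satisfies `r ^ 2 ≥ 5 * r - 6`; this is summed over the numbers of
representations of the elements of `A + B`. -/
lemma five_mul_card_le_addEnergy_add (A B : Finset (ZMod p)) :
    5 * (A.card * B.card) ≤ A.addEnergy B + 6 * (A + B).card := by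
  rw [addEnergy_eq_sum_sq', ← card_product,
    card_eq_sum_card_fiberwise (f := fun x : ZMod p × ZMod p => x.1 + x.2) (t := A + B)]
  · rw [mul_sum, mul_comm 6, ← smul_eq_mul (#(A + B)), ← sum_const, ← sum_add_distrib]
    refine sum_le_sum fun y _ => ?_
    generalize #{x ∈ A ×ˢ B | x.1 + x.2 = y} = r
    rcases Nat.lt_or_ge r 3 with h | h
    · interval_cases r <;> omega
    · obtain ⟨s, rfl⟩ := Nat.exists_eq_add_of_le h
      nlinarith
  · rintro ⟨a, b⟩ h
    simp only [coe_product, Set.mem_prod, mem_coe] at h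
    exact mem_coe.2 (add_mem_add h.1 h.2)

lemma IsAtom.le_sum_card_inter {k : ℕ} {X A : Finset (ZMod p)} (hA : IsAtom k X A)
    (hX : X.card = 4) (hkappa : kappa k X ≤ X.card + 1) :
    10 * A.card ≤ ∑ b ∈ X.offDiag, (A ∩ (A + {b.2 - b.1})).card + 30 := by
  have h1 := five_mul_card_le_addEnergy_add A X
  rw [addEnergy_eq_sum_card_inter, sum_card_inter_eq, hX] at h1
  have h2 := card_add_eq X A
  have h3 := hA.excess_eq
  omega

lemma IsAtom.exists_card_le_card_inter_add_three_of_five {X A : Finset (ZMod p)}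
    (hA : IsAtom 5 X A) (hX : X.card = 4) (hkappa : kappa 5 X ≤ X.card + 1)
    (h6 : 6 ≤ A.card) : A.card ≤ 7 ∧ ∃ d ≠ 0, A.card ≤ (A ∩ (A + {d})).card + 3 := by
  have hXne : X.Nonempty := card_pos.1 (by omega)
  have h1 := hA.le_sum_card_inter hX hkappa
  have hoff : X.offDiag.card = 12 := by rw [offDiag_card, hX]
  have h2 : ∑ b ∈ X.offDiag, (A ∩ (A + {b.2 - b.1})).card ≤ X.offDiag.card • 4 := by
    apply sum_le_card_nsmul
    intro b hb
    rw [mem_offDiag] at hb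
    exact Nat.lt_succ_iff.1 (hA.card_inter_lt hXne (by omega) (sub_ne_zero.2 (Ne.symm hb.2.2)))
  rw [hoff, smul_eq_mul] at h2
  refine ⟨by omega, ?_⟩
  by_contra! hcon
  have h3 : ∑ b ∈ X.offDiag, (A ∩ (A + {b.2 - b.1})).card ≤ X.offDiag.card • (A.card - 4) := by
    apply sum_le_card_nsmul
    intro b hb
    rw [mem_offDiag] at hb
    have := hcon _ (sub_ne_zero.2 (Ne.symm hb.2.2))
    omega
  rw [hoff, smul_eq_mul] at h3
  omega

/-! ### Atoms with six elements -/

/-- The set `V` of starting points of the pairs `{a, a + d}` in `A` is a Sidon set of minimal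
excess, and so are its translates. A translate meeting `A` in two points lies in `A`. -/
lemma IsAtom.false_of_card_eq_six {X A : Finset (ZMod p)} (hA : IsAtom 4 X A)
    (hp : X.card + 42 < p) (hkappa : kappa 4 X ≤ X.card + 1)
    (h6 : A.card = 6)
    (hlow : ∀ Z : Finset (ZMod p), 2 ≤ Z.card → (Z + X).card + 2 ≤ p →
      (X.card : ℤ) + 1 ≤ excess X Z)
    (hpair : ∀ f ≠ 0, (X.card : ℤ) + 1 + 1 ≤ excess X {0, f}) {d : ZMod p} (hd : d ≠ 0)
    (hI : (A ∩ (A + {d})).card = 3) : False := by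
  have hAe := hA.excess_eq
  have hAX := hA.card_add_le
  have hk := hlow A (by omega) (by omega)
  obtain ⟨V, hV⟩ : ∃ V, V = (A ∩ (A + {d})) + {-d} := ⟨_, rfl⟩
  have memV : ∀ {x}, x ∈ V ↔ x ∈ A ∧ x + d ∈ A := by
    intro x
    rw [hV, mem_add_singleton, mem_inter, mem_add_singleton]
    simp only [sub_neg_eq_add, add_sub_cancel_right, and_comm]
  have hVc : V.card = 3 := by rw [hV, card_add_singleton, hI]
  have hVe : excess X V ≤ X.card + 1 := by
    have h1 := excess_grow_add_excess_inter_le X A d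
    have h2 := card_grow d A
    have h3 := card_inter_add_card_ends d A
    have h4 : (X.card : ℤ) + 1 ≤ excess X (grow d A) := by
      by_contra hcon
      have h5 := card_add_eq X (grow d A)
      exact hcon (hlow _ (by omega) (by omega))
    rw [hV, excess_add_singleton]
    omega
  have hVsid : ∀ t ≠ 0, (V ∩ (V + {t})).card ≤ 1 := by
    intro t ht
    by_contra! hcon
    have h1 := card_union_le V (V + {t})
    rw [card_add_singleton] at h1
    have h2 := (excess_union_le_of_two_le hlow hpair hVe
      ((excess_add_singleton X V t).le.trans hVe) (by omega) hcon).2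
    have h3 := card_inter_translate_lt ht (Z := V) (by omega) (card_pos.1 (by omega))
    omega
  -- two points of a translate of `V` in `A` force the third one
  have hVA : ∀ f, 2 ≤ (A ∩ (V + {f})).card → V + {f} ⊆ A := by
    intro f hf
    have h1 := card_union_le A (V + {f})
    rw [card_add_singleton] at h1
    have h2 := (excess_union_le_of_two_le hlow hpair (by omega)
      ((excess_add_singleton X V f).le.trans hVe) (by omega) hf).2
    have h3 : (V + {f}).card ≤ (A ∩ (V + {f})).card := by
      rw [card_add_singleton]
      omega
    exact (eq_of_subset_of_card_le inter_subset_right h3) ▸ inter_subset_left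
  have hVd : V ∪ (V + {d}) ⊆ A := by
    refine union_subset (fun x hx => (memV.1 hx).1) fun x hx => ?_
    have := (memV.1 (mem_add_singleton.1 hx)).2
    rwa [sub_add_cancel] at this
  have hun := card_union_add_card_inter V (V + {d})
  rw [card_add_singleton] at hun
  rcases Nat.eq_zero_or_pos (V ∩ (V + {d})).card with h0 | hpos
  -- if `A` is the union of `V` and `V + d`, a third translate of `V` inside `A` would meet one of
  -- these two in two points
  · have hAeq : V ∪ (V + {d}) = A := eq_of_subset_of_card_le hVd (by omega)
    obtain ⟨x₀, hx₀, x₁, hx₁, hne⟩ := one_lt_card.1 (show 1 < V.card by omega)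
    have hx : x₁ - x₀ ≠ 0 := sub_ne_zero.2 hne.symm
    have hsub : ({x₁, x₁ + d} : Finset (ZMod p)) ⊆ A ∩ (A + {x₁ - x₀}) := by
      intro y hy
      simp only [mem_insert, mem_singleton] at hy
      rw [mem_inter, mem_add_singleton]
      rcases hy with rfl | rfl
      · exact ⟨(memV.1 hx₁).1, by rw [sub_sub_cancel]; exact (memV.1 hx₀).1⟩
      · refine ⟨(memV.1 hx₁).2, ?_⟩
        rw [show x₁ + d - (x₁ - x₀) = x₀ + d by ring]
        exact (memV.1 hx₀).2
    have hc2 : ({x₁, x₁ + d} : Finset (ZMod p)).card = 2 :=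
      card_pair fun h => hd (left_eq_add.1 h)
    have h1 := card_union_le A (A + {x₁ - x₀})
    rw [card_add_singleton] at h1
    have h2 := (excess_union_le_of_two_le hlow hpair (c := X.card + 1) (by omega)
      ((excess_add_singleton X A (x₁ - x₀)).le.trans (by omega)) (by omega)
      (hc2.ge.trans (card_le_card hsub))).2
    obtain ⟨w, hw, hw'⟩ := exists_mem_notMem_of_card_lt_card
      (show ({x₁, x₁ + d} : Finset (ZMod p)).card < (A ∩ (A + {x₁ - x₀})).card by
        have := card_le_card hsub
        omega)
    simp only [mem_insert, mem_singleton, not_or] at hw'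
    rw [mem_inter, mem_add_singleton] at hw
    have hsub2 : V + {w - x₁} ⊆ A := by
      apply hVA
      rw [← card_pair (show w ≠ w - (x₁ - x₀) from fun h => hx (by linear_combination h))]
      apply card_le_card
      intro y hy
      simp only [mem_insert, mem_singleton] at hy
      rw [mem_inter, mem_add_singleton]
      rcases hy with rfl | rfl
      · exact ⟨hw.1, by rwa [sub_sub_cancel]⟩
      · refine ⟨hw.2, ?_⟩
        rwa [show w - (x₁ - x₀) - (w - x₁) = x₀ by ring]
    have h3 := hVsid (w - x₁) (sub_ne_zero.2 hw'.1)
    have h4 := hVsid (w - x₁ - d) (fun h => hw'.2 (by linear_combination h))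
    rw [← card_inter_translate_add V d, add_assoc V {d}, singleton_add_singleton,
      add_sub_cancel] at h4
    have h5 : V + {w - x₁} ⊆ (V ∩ (V + {w - x₁})) ∪ ((V + {d}) ∩ (V + {w - x₁})) := by
      rw [← union_inter_distrib_right, hAeq]
      exact subset_inter hsub2 Subset.rfl
    have h6 := (card_le_card h5).trans (card_union_le _ _)
    rw [card_add_singleton] at h6
    omega
  -- otherwise `V` is a translate of `{0, d, v}` and `A` is a translate of its double
  · obtain ⟨o, ho⟩ := card_pos.1 hpos
    rw [mem_inter, mem_add_singleton] at ho
    obtain ⟨z, hz, hz'⟩ := exists_mem_notMem_of_card_lt_card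
      (show ({o - d, o} : Finset (ZMod p)).card < V.card by
        have := card_le_two (a := o - d) (b := o)
        omega)
    simp only [mem_insert, mem_singleton, not_or] at hz'
    obtain ⟨v, rfl⟩ : ∃ v, z = v + (o - d) := ⟨z - (o - d), by ring⟩
    have hv : v ≠ 0 := fun h => hz'.1 (by rw [h, zero_add])
    have hdv : d ≠ v := fun h => hz'.2 (by rw [← h]; ring)
    have hVeq : V = {0, d, v} + {o - d} := by
      symm
      refine eq_of_subset_of_card_le ?_ ?_
      · intro y hy
        rw [mem_add_singleton] at hy
        simp only [mem_insert, mem_singleton] at hy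
        rcases hy with hy | hy | hy
        · rw [sub_eq_zero.1 hy]; exact ho.2
        · rw [show y = o by linear_combination hy]; exact ho.1
        · rw [show y = v + (o - d) by linear_combination hy]; exact hz
      · rw [card_add_singleton, card_eq_three.2 ⟨0, d, v, hd.symm, hv.symm, hdv, rfl⟩, hVc]
    have hVv : V + {v} ⊆ A := by
      apply hVA
      rw [← card_pair (show v + (o - d) ≠ v + o from fun h => hd (by linear_combination -h))]
      apply card_le_card
      intro y hy
      simp only [mem_insert, mem_singleton] at hy
      rw [mem_inter, mem_add_singleton]
      rcases hy with rfl | rfl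
      · exact ⟨(memV.1 hz).1, by rw [add_sub_cancel_left]; exact ho.2⟩
      · refine ⟨?_, by rw [add_sub_cancel_left]; exact ho.1⟩
        have := (memV.1 hz).2
        convert this using 1
        ring
    rw [hVeq] at hVsid hVe hVd hVv hun
    simp only [card_inter_translate_add, excess_add_singleton] at hVsid hVe
    obtain ⟨h2d, h2v⟩ := sidon_triple_ne hd hv hdv hVsid
    have hAeq : {0, d, v, 2 * d, 2 * v, d + v} + {o - d} = A := by
      have hsub : {0, d, v, 2 * d, 2 * v, d + v} + {o - d} ⊆ A := by
        rw [← triangle_union_translates, union_add, union_add,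
          add_right_comm ({0, d, v} : Finset (ZMod p)) {d},
          add_right_comm ({0, d, v} : Finset (ZMod p)) {v}]
        exact union_subset hVd hVv
      refine eq_of_subset_of_card_le hsub ?_
      rw [← triangle_union_translates, card_add_singleton]
      have h1 := card_union_add_card_inter ({0, d, v} ∪ ({0, d, v} + {d}))
        (({0, d, v} : Finset (ZMod p)) + {v})
      rw [triangle_inter_translate (by omega) hv hdv h2v, card_add_singleton, card_add_singleton,
        card_pair hd.symm] at h1
      have h2 := card_union_add_card_inter {0, d, v} (({0, d, v} : Finset (ZMod p)) + {d})
      have h3 := hVsid d hd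
      rw [card_add_singleton] at h2
      rw [hVeq, card_add_singleton] at hVc
      omega
    rw [← hAeq, excess_add_singleton] at hAe
    exact false_of_triangle hlow hpair (by omega) (by omega) hd hv hdv h2d h2v hVe (by omega)

/-! ### Sidon sets with four elements -/

/-- Two translates of a Sidon set meet in at most one point, so each element of `I` that comes after
`j` others adds at least `4 - j` points to the sumset with `X`. -/
lemma sum_le_excess_of_sidon {X : Finset (ZMod p)} (hX : X.card = 4)
    (hsid : ∀ t ≠ 0, (X ∩ (X + {t})).card ≤ 1) (I : Finset (ZMod p)) :
    ∑ j ∈ range I.card, (3 - (j : ℤ)) ≤ excess X I := by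
  classical
  induction I using Finset.induction_on with
  | empty => simp [excess]
  | insert a I ha ih =>
    rw [card_insert_of_notMem ha, sum_range_succ]
    have h1 : (insert a I + X).card + ((X + {a}) ∩ (I + X)).card = 4 + (I + X).card := by
      rw [insert_eq, union_add, add_comm {a} X, card_union_add_card_inter, card_add_singleton, hX]
    have h2 : ((X + {a}) ∩ (I + X)).card ≤ I.card := by
      have hsub : (X + {a}) ∩ (I + X) ⊆ I.biUnion fun i => (X + {a}) ∩ (X + {i}) := by
        intro y hy
        obtain ⟨hy1, hy2⟩ := mem_inter.1 hy
        obtain ⟨i, hi, x, hx, rfl⟩ := mem_add.1 hy2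
        refine mem_biUnion.2 ⟨i, hi, mem_inter.2 ⟨hy1, ?_⟩⟩
        rw [mem_add_singleton, add_sub_cancel_left]
        exact hx
      refine (card_le_card hsub).trans (card_biUnion_le.trans ?_)
      rw [card_eq_sum_ones]
      refine sum_le_sum fun i hi => ?_
      have := hsid (i - a) (sub_ne_zero.2 fun h => ha (h ▸ hi))
      rwa [← card_inter_translate_add X a, add_assoc X {a}, singleton_add_singleton,
        add_sub_cancel] at this
    have h3 := card_insert_of_notMem ha
    have h4 := card_add_eq X I
    have h5 := card_add_eq X (insert a I)
    omega

lemma six_le_excess_of_sidon {X : Finset (ZMod p)} (hX : X.card = 4)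
    (hsid : ∀ t ≠ 0, (X ∩ (X + {t})).card ≤ 1) {I : Finset (ZMod p)} (h3 : 3 ≤ I.card)
    (h4 : I.card ≤ 4) : 6 ≤ excess X I := by
  refine le_trans ?_ (sum_le_excess_of_sidon hX hsid I)
  interval_cases I.card <;> decide

lemma five_le_excess_of_sidon {X : Finset (ZMod p)} (hX : X.card = 4)
    (hsid : ∀ t ≠ 0, (X ∩ (X + {t})).card ≤ 1) {I : Finset (ZMod p)} (h2 : I.card = 2) :
    5 ≤ excess X I := by
  refine le_trans ?_ (sum_le_excess_of_sidon hX hsid I)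
  rw [h2]
  decide

/-- If `X` is a Sidon set, an intersection `A ∩ (A + d)` of three or four points has excess at least
`6`, and by submodularity `A ∪ (A + d)` would have excess below `κ_k(X)`. -/
lemma IsAtom.false_of_sidon {k : ℕ} {X A : Finset (ZMod p)} (hA : IsAtom k X A)
    (hX : X.card = 4) (hsid : ∀ t ≠ 0, (X ∩ (X + {t})).card ≤ 1) (hp : X.card + 42 < p)
    (hkappa : kappa k X ≤ 5) (hk : k ≤ 5) (hm : A.card ≤ 7) {d : ZMod p}
    (h3 : 3 ≤ (A ∩ (A + {d})).card) (h4 : (A ∩ (A + {d})).card ≤ 4) : False := by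
  have h1 := six_le_excess_of_sidon hX hsid h3 h4
  have h2 := excess_grow_add_excess_inter_le X A d
  have h5 := card_grow d A
  have h6 := card_inter_add_card_ends d A
  have h7 := hA.excess_eq
  have h8 := card_add_eq X (grow d A)
  have h9 := hA.le_card
  have := kappa_le_excess (k := k) (S := X) (Z := grow d A) (by omega) (by omega)
  omega

lemma card_inter_translate_neg (A : Finset (ZMod p)) (x : ZMod p) :
    (A ∩ (A + {-x})).card = (A ∩ (A + {x})).card := by
  have h := card_inter_translate_add A x (-x)
  rw [add_assoc A, singleton_add_singleton, add_neg_cancel, singleton_zero, add_zero,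
    inter_comm] at h
  exact h.symm

/-- By an energy estimate, two differences of `X`, distinct up to sign, occur exactly twice as
differences of the atom. -/
lemma exists_two_differences {X A : Finset (ZMod p)} (hA : IsAtom 4 X A) (hX : X.card = 4)
    (hsid : ∀ t ≠ 0, (X ∩ (X + {t})).card ≤ 1) (hkappa : kappa 4 X = 5) (hm : A.card = 5)
    (hle : ∀ t ≠ 0, (A ∩ (A + {t})).card ≤ 2) :
    ∃ x y, x ≠ 0 ∧ y ≠ 0 ∧ x ≠ y ∧ x ≠ -y ∧ (A ∩ (A + {x})).card = 2 ∧
      (A ∩ (A + {y})).card = 2 := by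
  classical
  set f : ZMod p × ZMod p → ℕ := fun b => (A ∩ (A + {b.2 - b.1})).card with hf
  set T := X.offDiag.filter fun b => f b = 2 with hT
  have hsum : 10 * A.card ≤ ∑ b ∈ X.offDiag, f b + 30 :=
    hA.le_sum_card_inter hX (by rw [hkappa, hX]; norm_num)
  have hbd : ∑ b ∈ X.offDiag, f b ≤ ∑ b ∈ X.offDiag, (1 + if f b = 2 then 1 else 0) := by
    refine sum_le_sum fun b hb => ?_
    rw [mem_offDiag] at hb
    have : f b ≤ 2 := hle _ (sub_ne_zero.2 (Ne.symm hb.2.2))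
    split_ifs <;> omega
  rw [sum_add_distrib, ← card_eq_sum_ones, ← card_filter, offDiag_card, hX, ← hT] at hbd
  obtain ⟨b, hb⟩ := card_pos.1 (show 0 < T.card by omega)
  obtain ⟨b', hb', hne⟩ := exists_mem_notMem_of_card_lt_card
    (show ({b, b.swap} : Finset (ZMod p × ZMod p)).card < T.card by
      have := card_le_two (a := b) (b := b.swap)
      omega)
  rw [hT, mem_filter, mem_offDiag] at hb hb'
  simp only [mem_insert, mem_singleton, not_or] at hne
  obtain ⟨⟨b1, b2, b3⟩, b4⟩ := hb
  obtain ⟨⟨c1, c2, c3⟩, c4⟩ := hb'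
  -- a difference of a Sidon set determines the pair
  have huniq : ∀ u ∈ X, ∀ v ∈ X, ∀ u' ∈ X, ∀ v' ∈ X, u ≠ v → v - u = v' - u' →
      u = u' ∧ v = v' := by
    intro u hu v hv u' hu' v' hv' huv he
    have h1 := card_le_one.1 (hsid (v - u) (sub_ne_zero.2 huv.symm)) v
      (mem_inter.2 ⟨hv, mem_add_singleton.2 (by rwa [sub_sub_cancel])⟩) v'
      (mem_inter.2 ⟨hv', mem_add_singleton.2 (by rwa [he, sub_sub_cancel])⟩)
    refine ⟨?_, h1⟩
    rw [h1] at he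
    exact sub_right_injective he
  refine ⟨b.2 - b.1, b'.2 - b'.1, sub_ne_zero.2 b3.symm, sub_ne_zero.2 c3.symm, fun h => ?_,
    fun h => ?_, b4, c4⟩
  · obtain ⟨h1, h2⟩ := huniq _ b1 _ b2 _ c1 _ c2 b3 h
    exact hne.1 (Prod.ext h1.symm h2.symm)
  · rw [neg_sub] at h
    obtain ⟨h1, h2⟩ := huniq _ b1 _ b2 _ c2 _ c1 b3 h
    exact hne.2 (Prod.ext h2.symm h1.symm)

/-- If the difference `z` occurs twice in `A`, at least three elements of `A` are involved. -/
lemma exists_subset_of_card_inter_eq_two {A : Finset (ZMod p)} {z : ZMod p} (hz : z ≠ 0)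
    (hp : 2 < p) (h : (A ∩ (A + {z})).card = 2) :
    ∃ R ⊆ A, 3 ≤ R.card ∧ ∀ o ∈ R, o + z ∈ A ∨ o + -z ∈ A := by
  have h1 := card_grow (-z) (A ∩ (A + {z}))
  have h2 := ends_nonempty (neg_ne_zero.2 hz) (Z := A ∩ (A + {z})) (by omega)
    (card_pos.1 (by omega))
  have key : ∀ o ∈ grow (-z) (A ∩ (A + {z})), o ∈ A ∧ (o + z ∈ A ∨ o + -z ∈ A) := by
    intro o ho
    simp only [mem_grow, mem_inter, mem_add_singleton, sub_neg_eq_add, add_sub_cancel_right] at ho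
    rcases ho with ⟨h1, h2⟩ | ⟨h1, h2⟩
    · exact ⟨h1, Or.inr (by rwa [← sub_eq_add_neg])⟩
    · exact ⟨h2, Or.inl h1⟩
  exact ⟨_, fun o ho => (key o ho).1, by omega, fun o ho => (key o ho).2⟩

lemma card_union_union_le_four {α : Type*} [DecidableEq α] {P Q R : Finset α} {s : α}
    (hP : s ∈ P) (hQ : s ∈ Q) (hR : s ∈ R) (hP2 : P.card ≤ 2) (hQ2 : Q.card ≤ 2)
    (hR2 : R.card ≤ 2) :
    (P ∪ Q ∪ R).card ≤ 4 := by
  have h1 := card_union_add_card_inter P Q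
  have h2 := card_union_add_card_inter (P ∪ Q) R
  have h3 := card_pos.2 ⟨s, mem_inter.2 ⟨hP, hQ⟩⟩
  have h4 := card_pos.2 ⟨s, mem_inter.2 ⟨mem_union_left Q hP, hR⟩⟩
  omega

/-- For a Sidon set `X` with four elements, two differences `x` and `y`, distinct up to sign, that
occur twice in the atom lead to a translate of the atom meeting the union of three others in three
or four points, which makes the excess of the union too small. -/
lemma IsAtom.false_of_sidon_of_card_eq_five {X A : Finset (ZMod p)} (hA : IsAtom 4 X A)
    (hX : X.card = 4) (hsid : ∀ t ≠ 0, (X ∩ (X + {t})).card ≤ 1) (hp : X.card + 42 < p)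
    (hkappa : kappa 4 X = 5) (hm : A.card = 5) : False := by
  classical
  have hXne : X.Nonempty := card_pos.1 (by omega)
  have hAe := hA.excess_eq
  rw [hkappa] at hAe
  have hle : ∀ t ≠ 0, (A ∩ (A + {t})).card ≤ 2 := by
    intro t ht
    by_contra! hcon
    have h1 := hA.card_inter_lt hXne (by omega) ht
    exact hA.false_of_sidon hX hsid hp hkappa.le (by omega) (by omega) hcon (by omega)
  obtain ⟨x₀, y₀, hx₀, hy₀, hxy₀, hxy₀', hx₀2, hy₀2⟩ :=
    exists_two_differences hA hX hsid hkappa hm hle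
  obtain ⟨o, x, y, hox, hoy, ho, hx, hy, hxy, hxy', hx2, hy2⟩ : ∃ o x y, o + x ∈ A ∧ o + y ∈ A ∧
      o ∈ A ∧ x ≠ 0 ∧ y ≠ 0 ∧ x ≠ y ∧ x ≠ -y ∧ (A ∩ (A + {x})).card = 2 ∧
      (A ∩ (A + {y})).card = 2 := by
    obtain ⟨R, hRA, hR3, hR⟩ := exists_subset_of_card_inter_eq_two hx₀ (by omega) hx₀2
    obtain ⟨R', hRA', hR3', hR'⟩ := exists_subset_of_card_inter_eq_two hy₀ (by omega) hy₀2
    have h1 := card_union_add_card_inter R R'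
    have h2 := card_le_card (union_subset hRA hRA')
    obtain ⟨o, ho⟩ := card_pos.1 (show 0 < (R ∩ R').card by omega)
    obtain ⟨ho1, ho2⟩ := mem_inter.1 ho
    have hx' := card_inter_translate_neg A x₀
    have hy' := card_inter_translate_neg A y₀
    have hxn := neg_ne_zero.2 hx₀
    have hyn := neg_ne_zero.2 hy₀
    have e1 : -x₀ ≠ y₀ := fun h => hxy₀' (by rw [← h, neg_neg])
    have e2 : -x₀ ≠ -y₀ := fun h => hxy₀ (neg_injective h)
    rcases hR o ho1 with h | h <;> rcases hR' o ho2 with h' | h'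
    · exact ⟨o, x₀, y₀, h, h', hRA ho1, hx₀, hy₀, hxy₀, hxy₀', hx₀2, hy₀2⟩
    · exact ⟨o, x₀, -y₀, h, h', hRA ho1, hx₀, hyn, hxy₀', by rwa [neg_neg], hx₀2, hy'.trans hy₀2⟩
    · exact ⟨o, -x₀, y₀, h, h', hRA ho1, hxn, hy₀, e1, e2, hx'.trans hx₀2, hy₀2⟩
    · exact ⟨o, -x₀, -y₀, h, h', hRA ho1, hxn, hyn, e2, by rwa [neg_neg], hx'.trans hx₀2,
        hy'.trans hy₀2⟩
  -- no union of translates of excess `5` meets a translate of `A` in three or four points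
  have hcap : ∀ (Z : Finset (ZMod p)) (t : ZMod p), excess X Z ≤ 5 → Z.card ≤ 15 →
      3 ≤ (Z ∩ (A + {t})).card → (Z ∩ (A + {t})).card ≤ 4 → False := by
    intro Z t hZ hZc h3 h4
    have h1 := six_le_excess_of_sidon hX hsid h3 h4
    have h2 := excess_union_add_excess_inter_le X Z (A + {t})
    rw [excess_add_singleton] at h2
    have h5 := card_union_le Z (A + {t})
    have h6 : (A + {t}).card ≤ (Z ∪ (A + {t})).card := card_le_card subset_union_right
    rw [card_add_singleton] at h5 h6
    have h7 := card_add_eq X (Z ∪ (A + {t}))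
    have := kappa_le_excess (k := 4) (S := X) (Z := Z ∪ (A + {t})) (by omega) (by omega)
    omega
  have hcomm : ∀ s t : ZMod p, ((A + {s}) ∩ (A + {t})).card = (A ∩ (A + {t - s})).card := by
    intro s t
    rw [← card_inter_translate_add A s, add_assoc A {s}, singleton_add_singleton, add_sub_cancel]
  have memA : ∀ {z s : ZMod p}, z ∈ A + {s} ↔ z - s ∈ A := mem_add_singleton
  -- `A ∪ (A + x)` has excess at most `5`, whence `A + y` meets it only inside `A`
  have hU := excess_union_add_excess_inter_le X A (A + {x})
  rw [excess_add_singleton] at hU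
  have hpx := five_le_excess_of_sidon hX hsid hx2
  have hUc := card_union_le A (A + {x})
  rw [card_add_singleton] at hUc
  have hUy : ((A ∪ (A + {x})) ∩ (A + {y})).card ≤ 4 := by
    rw [union_inter_distrib_right]
    refine (card_union_le _ _).trans ?_
    rw [hcomm]
    have := hle (y - x) (sub_ne_zero.2 hxy.symm)
    omega
  have hsub : A ∩ (A + {y}) ⊆ (A ∪ (A + {x})) ∩ (A + {y}) :=
    inter_subset_inter_right subset_union_left
  have hUy2 : A ∩ (A + {y}) = (A ∪ (A + {x})) ∩ (A + {y}) := by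
    refine eq_of_subset_of_card_le hsub ?_
    by_contra hcon
    exact hcap _ y (by omega) (by omega) (by omega) hUy
  have hs : o + x + y ∈ A := by
    have : o + x + y ∈ (A ∪ (A + {x})) ∩ (A + {y}) := by
      rw [mem_inter, mem_union, memA, memA, add_sub_cancel_right, add_right_comm,
        add_sub_cancel_right]
      exact ⟨Or.inr hoy, hox⟩
    rw [← hUy2, mem_inter] at this
    exact this.1
  -- `A ∪ (A + x) ∪ (A + y)` has excess at most `5` too
  have hW := excess_union_add_excess_inter_le X (A ∪ (A + {x})) (A + {y})
  rw [excess_add_singleton, ← hUy2] at hW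
  have hpy := five_le_excess_of_sidon hX hsid hy2
  have hWc := card_union_le (A ∪ (A + {x})) (A + {y})
  rw [card_add_singleton] at hWc
  have hxy0 : x + y ≠ 0 := fun h => hxy' (eq_neg_of_add_eq_zero_left h)
  obtain ⟨a, ha, ha'⟩ := exists_mem_notMem_of_card_lt_card
    (show ({o + y} : Finset (ZMod p)).card < (A ∩ (A + {y})).card by rw [card_singleton]; omega)
  obtain ⟨b, hb, hb'⟩ := exists_mem_notMem_of_card_lt_card
    (show ({o + x} : Finset (ZMod p)).card < (A ∩ (A + {x})).card by rw [card_singleton]; omega)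
  rw [mem_inter, memA] at ha hb
  rw [mem_singleton] at ha' hb'
  have hab : a + x ≠ b + y := by
    intro h
    -- otherwise `A` and `A + (w - o)` share the three points `w`, `w + x`, `w + y`
    have hw : a - y - o ≠ 0 := fun h => ha' (by linear_combination h)
    have h3 : ({a - y, b, a} : Finset (ZMod p)).card = 3 := by
      refine card_eq_three.2 ⟨_, _, _, fun h' => hx ?_, fun h' => hy ?_, fun h' => hxy ?_, rfl⟩
      · linear_combination h - h'
      · linear_combination -h'
      · linear_combination h + h'
    have h4 : ({a - y, b, a} : Finset (ZMod p)) ⊆ A ∩ (A + {a - y - o}) := by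
      intro z hz
      simp only [mem_insert, mem_singleton] at hz
      rw [mem_inter, memA]
      rcases hz with rfl | rfl | rfl
      · exact ⟨ha.2, by rwa [sub_sub_cancel]⟩
      · exact ⟨hb.1, by rwa [show z - (a - y - o) = o + x by linear_combination -h]⟩
      · exact ⟨ha.1, by rwa [show z - (z - y - o) = o + y by ring]⟩
    have h5 := card_le_card h4
    have h6 := hle _ hw
    omega
  refine hcap (A ∪ (A + {x}) ∪ (A + {y})) (x + y) (by omega) (by omega) ?_ ?_
  · have h3 : ({o + x + y, a + x, b + y} : Finset (ZMod p)).card = 3 := by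
      refine card_eq_three.2 ⟨_, _, _, fun h => ha' ?_, fun h => hb' ?_, hab, rfl⟩
      · linear_combination -h
      · linear_combination -h
    rw [← h3]
    refine card_le_card fun z hz => ?_
    simp only [mem_insert, mem_singleton] at hz
    rw [mem_inter, mem_union, mem_union, memA, memA, memA]
    rcases hz with rfl | rfl | rfl
    · exact ⟨Or.inl (Or.inl hs), by rwa [show o + x + y - (x + y) = o by ring]⟩
    · exact ⟨Or.inl (Or.inr (by rw [add_sub_cancel_right]; exact ha.1)),
        by rw [show a + x - (x + y) = a - y by ring]; exact ha.2⟩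
    · exact ⟨Or.inr (by rw [add_sub_cancel_right]; exact hb.1),
        by rw [show b + y - (x + y) = b - x by ring]; exact hb.2⟩
  · have hmem : o + x + y ∈ A + {x + y} :=
      memA.2 (by rwa [show o + x + y - (x + y) = o by ring])
    rw [union_inter_distrib_right, union_inter_distrib_right]
    refine card_union_union_le_four (s := o + x + y) (mem_inter.2 ⟨hs, hmem⟩)
      (mem_inter.2 ⟨memA.2 (by rwa [show o + x + y - x = o + y by ring]), hmem⟩)
      (mem_inter.2 ⟨memA.2 (by rwa [add_sub_cancel_right]), hmem⟩) (hle _ hxy0) ?_ ?_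
    · rw [hcomm, add_sub_cancel_left]
      exact hy2.le
    · rw [hcomm, add_sub_cancel_right]
      exact hx2.le

/-! ### Atoms of minimal size -/

/-- Suppose that `X` attains `κ₂(A) = |A| + 1` and has few runs for some difference. Then the atom
`A` lies in a short progression. -/
lemma IsAtom.false_of_excess_pair_le {k : ℕ} {X A : Finset (ZMod p)} (hA : IsAtom k X A)
    (hk : 4 ≤ k) (hkA : k < A.card) (hm : A.card ≤ 7) (hp : X.card + 42 < p)
    (hkappa : kappa k X = X.card + 1) (hlow : (A.card : ℤ) + 1 ≤ kappa 2 A) {d : ZMod p}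
    (hd : d ≠ 0) {r : ℕ} (hr : (ends d X).card ≤ r) (hr3 : r ≤ 3) (hrX : r + 2 ≤ X.card)
    (hroom : (A.card + 1) * ∑ i ∈ range (r + 1), i ≤ 42) : False := by
  have hXne : X.Nonempty := card_pos.1 (by omega)
  have hAne : A.Nonempty := card_pos.1 (by omega)
  have h1 := excess_comm A X
  rw [hA.excess_eq] at h1
  have h2 := card_inter_add_card_ends d X
  obtain ⟨q, hq1, hq2, c, hc⟩ := exists_forall_natCast_mul_eq (S := A) (N := A.card + 1) hd hAne
    (fun Z h1 h2 => by have := kappa_le_excess h1 h2; push_cast; omega) r X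
    (by push_cast; omega) (by omega) hr (by omega)
  obtain ⟨δ, hδ, c', hsub⟩ := subset_prog_of_forall_natCast_mul_eq hd hq1 (by omega) hc
  exact hA.false_of_subset_prog hXne hkA (by omega) hm hkappa.le hp hδ hsub

/-- A `k`-atom with more than `k` elements cannot meet a translate of itself in all but at most
three points. By the case of two runs, `A` has at least three runs for every difference, so that
`κ₂(A) = |A| + 1` is attained by `X`. If `X` has at most two runs for some difference, or three and
at least five elements, then `A` is contained in a short progression. Otherwise `X` is a Sidon set
with four elements, or there is no pair of minimal excess. -/
lemma IsAtom.false_of_card_le_card_inter_add_three {k : ℕ} {X A : Finset (ZMod p)}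
    (hA : IsAtom k X A) (hk4 : 4 ≤ k) (hk5 : k ≤ 5) (hX : 4 ≤ X.card) (h54 : k = 5 → X.card = 4)
    (hp : X.card + 42 < p) (hkappa : kappa k X ≤ X.card + 1) (hkA : k < A.card) {d : ZMod p}
    (hd : d ≠ 0) (hI : A.card ≤ (A ∩ (A + {d})).card + 3) : False := by
  have hXne : X.Nonempty := card_pos.1 (by omega)
  have hAne : A.Nonempty := card_pos.1 (by omega)
  have hAX := hA.card_add_le
  have hAe := hA.excess_eq
  have hIlt := hA.card_inter_lt hXne (by omega) hd
  have hAXc := card_add_eq X A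
  have hcd := le_excess_of_lt hXne hAne (by omega)
  have hdual := hA.card_add_card_add_le
  have hinter := card_inter_add_card_ends d A
  have hm : A.card ≤ k + 2 := by omega
  have hthree : ∀ f ≠ 0, 3 ≤ (ends f A).card := by
    intro f hf
    by_contra! hlt
    have h1 := card_inter_add_card_ends f A
    have h2 := hA.card_inter_lt hXne (by omega) hf
    exact hA.false_of_ends_le_two hk4 hk5 hX hp hkappa (by omega) hf (by omega)
  have hlow : (A.card : ℤ) + 1 ≤ kappa 2 A := by
    by_contra! hlt
    obtain ⟨f, hf, hpf⟩ := exists_excess_pair_eq (S := A) (by omega) (by omega) (by omega)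
    rw [excess_pair A hf] at hpf
    have := hthree f hf
    omega
  have hXA := kappa_le_excess (k := 2) (S := A) (Z := X) (by omega) (by rw [add_comm X]; omega)
  rw [excess_comm, hAe] at hXA
  have hk : kappa k X = X.card + 1 := by omega
  have hroom2 : (A.card + 1) * ∑ i ∈ range (2 + 1), i ≤ 42 := by
    rw [show ∑ i ∈ range (2 + 1), i = 3 from rfl]
    omega
  by_cases hX2 : kappa 2 X ≤ X.card
  · obtain ⟨f, hf, hpf⟩ := exists_excess_pair_eq (S := X) (by omega) hX2 (by omega)
    rw [excess_pair X hf] at hpf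
    exact hA.false_of_excess_pair_le hk4 hkA (by omega) hp hk hlow hf (r := 2) (by omega)
      (by omega) (by omega) hroom2
  · have hpair3 : ∀ f ≠ 0, 3 ≤ (ends f X).card := by
      intro f hf
      by_contra! hlt
      have h1 := excess_pair X hf
      have h2 := card_add_eq X {0, f}
      rw [card_pair hf.symm] at h2
      have := kappa_le_excess (k := 2) (S := X) (Z := {0, f}) (card_pair hf.symm).ge (by omega)
      omega
    rcases Nat.eq_or_lt_of_le hX with h4 | h5
    · have hsid : ∀ t ≠ 0, (X ∩ (X + {t})).card ≤ 1 := by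
        intro t ht
        have h1 := card_inter_add_card_ends t X
        have h2 := hpair3 t ht
        omega
      by_cases h3 : 3 ≤ (A ∩ (A + {d})).card
      · exact hA.false_of_sidon h4.symm hsid hp (by omega) hk5 (by omega) h3 (by omega)
      · obtain rfl : k = 4 := by omega
        exact hA.false_of_sidon_of_card_eq_five h4.symm hsid hp (by omega) (by omega)
    · obtain rfl : k = 4 := by omega
      have hlowX : ∀ Z : Finset (ZMod p), 2 ≤ Z.card → (Z + X).card + 2 ≤ p →
          (X.card : ℤ) + 1 ≤ excess X Z := fun Z h1 h2 => by
        have := kappa_le_excess h1 h2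
        omega
      -- a pair of minimal excess, that is, a difference with three runs in `X`
      obtain ⟨f, hf, hf3⟩ : ∃ f ≠ 0, excess X {0, f} ≤ X.card + 1 := by
        by_contra! hcon
        by_cases h6 : A.card = 6
        · exact hA.false_of_card_eq_six hp hkappa h6 hlowX
            (fun f hf => Int.add_one_le_of_lt (hcon f hf)) hd (by omega)
        · have h7 : (A ∩ (A + {d})).card = 2 ∨ 3 ≤ (A ∩ (A + {d})).card := by omega
          rcases h7 with h7 | h7
          · have h8 := excess_grow_add_excess_inter_le X A d
            have h9 := card_grow d A
            have h10 : kappa 4 X ≤ excess X (grow d A) := by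
              by_contra hlt
              have h11 := card_add_eq X (grow d A)
              exact hlt (kappa_le_excess (by omega) (by omega))
            obtain ⟨f, hf, t, ht⟩ := exists_eq_pair_add h7
            rw [ht, excess_add_singleton] at h8
            have := hcon f hf
            omega
          · have := hthree d hd
            omega
      rw [excess_pair X hf] at hf3
      refine hA.false_of_excess_pair_le hk4 hkA (by omega) hp hk hlow hf (r := 3) (by omega)
        le_rfl (by omega) ?_
      rw [show ∑ i ∈ range (3 + 1), i = 6 from rfl]
      omega

end Isoperimetric

theorem mainTheorem3 (p : ℕ) [Fact p.Prime] (X : Finset (ZMod p))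
    (h0 : (0 : ZMod p) ∈ X) (hX : 4 ≤ X.card)
    (hkappa : Isoperimetric.kappa 5 X ≤ (X.card : ℤ) + 1)
    (hp : X.card + 42 < p) :
    (∀ A : Finset (ZMod p), Isoperimetric.IsAtom 4 X A → A.card = 4) ∧
    (X.card = 4 → ∀ A : Finset (ZMod p), Isoperimetric.IsAtom 5 X A → A.card = 5) := by
  constructor
  · intro A hA
    have hmono := Isoperimetric.kappa_mono (S := X) (show 4 ≤ 5 by norm_num) (by omega)
    by_contra hne
    have hle := hA.le_card
    obtain ⟨d, hd, hI⟩ := hA.exists_card_le_card_inter_add_three (by omega) hp (by omega)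
      (by omega)
    exact hA.false_of_card_le_card_inter_add_three (by omega) (by omega) hX (by omega) hp
      (by omega) (by omega) hd hI
  · intro hX4 A hA
    by_contra hne
    have hle := hA.le_card
    obtain ⟨-, d, hd, hI⟩ := hA.exists_card_le_card_inter_add_three_of_five hX4 hkappa (by omega)
    exact hA.false_of_card_le_card_inter_add_three (by omega) (by omega) hX (fun _ => hX4) hp
      hkappa (by omega) hd hI
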